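/- **Theorem 1.** For a graph $H$ let $\nu(H)$ be the size of a maximum matching of $H$. Let $G$ be an undirected simple graph on $n$ vertices with $k$ distinguished vertices (terminals) $q_1,\dots,q_k$. A *query* is a set $Q$ of edges between terminals, and $G^Q$ is the graph obtained from $G$ by inserting all edges of $Q$. A *randomized $k$-dynamic sketching scheme* for maximum matching is a pair of randomized algorithms: a compression algorithm, which given $G$ and its terminals outputs a sketch $\Gamma$, and an extraction algorithm, which given only $Q$ and $\Gamma$ outputs a number, meant to be $\nu(G^Q)$. The size of a sketch is its number of machine words of $\lfloor\log_2 n\rfloor+1$ bits. There is an absolute constant $C$ such that for every $0<\delta<1$ and every $k\ge 1$ there is a randomized $k$-dynamic sketching scheme for maximum matching such that 1. for all $G$ and all choices of $k$ terminals, every sketch it outputs has at most $C\,k^2\max\{1,\log(1/\delta)\}$ words; 2. for all $G$, all choices of $k$ terminals and each query $Q$, the answer equals $\nu(G^Q)$ with probability at least $1-\delta$; 3. the scheme has the following form. For each $n \geq 1$ it uses a prime $p$ with $n/\delta\le p\le C\,n/\delta$. Compression evaluates the Tutte matrix of $G$ at independent uniform elements of $\mathbb{Z}_p$; with the terminals first,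 write the result as $\begin{bmatrix}A_0&B\\ C_0&D\end{bmatrix}$, where $A_0$ is $k\times k$. Invertible row operations $R$ and column operations $S$ turn $D$ into a diagonal matrix $RDS$ with $r=\operatorname{rank}(D)$ ones on the diagonal and zeros elsewhere. Let $X$ be the columns of $BS$ and $Y$ the rows of $RC_0$ in the positions of these ones, and let $B'$ and $C'$ be the remaining columns and rows. Put $A'=A_0-XY$. Let $B''$ be a $k\times k$ matrix consisting of $k$ distinct columns of $B'$ that include a maximal linearly independent set of columns (all columns of $B'$, filled up with zero columns, if there are fewer than $k$), and let $C''$ be obtained likewise from the rows of $C'$. Let $\hat A$ be a $k\times k$ matrix of further independent uniform elements of $\mathbb{Z}_p$. The sketch encodes (injectively) $r,\hat A,A',B'',C''$. Given $Q$, let $A_Q$ be the Tutte matrix of the graph $Q$ on $q_1,\dots,q_k$ with the variable $x_{ij}$ ($i<j$) evaluated at $\hat A_{ij}$; the extraction algorithm returns $$\tfrac12\bigl(\operatorname{rank}(\hat M)+r\bigr),\qquad \hat M=\begin{bmatrix}A_Q+A'&B''\\ C''&0\end{bmatrix}.$$ Here the Tutte matrix of a graph on ordered vertices has entry $x_{ij}$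 if $ij$ is an edge and $i<j$, entry $-x_{ji}$ if $ij$ is an edge and $i>j$, and entry $0$ otherwise. -/

import Mathlib

/-! ### Matchings and the model -/

/-- The size `ν(G)` of a maximum matching of `G`. -/
noncomputable def matchingNumber {n : ℕ} (G : SimpleGraph (Fin n)) : ℕ :=
  sSup {m : ℕ | ∃ M : G.Subgraph, M.IsMatching ∧ M.edgeSet.ncard = m}

/-- A randomized algorithm from `α` to `β`: on input `a` it draws `draws a` independent uniform
elements of `{0, …, bound a}` and outputs a value depending on `a` and these numbers. All the
functions involved are computable (total recursive). -/
structure RandomizedAlgorithm (α β : Type) [Primcodable α] [Primcodable β] where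
  draws : α → ℕ
  bound : α → ℕ
  run : α → List ℕ → β
  computable_draws : Computable draws
  computable_bound : Computable bound
  computable_run : Computable₂ run

/-- The distribution of the output of a randomized algorithm on the input `a`. -/
noncomputable def RandomizedAlgorithm.dist {α β : Type} [Primcodable α] [Primcodable β]
    (A : RandomizedAlgorithm α β) (a : α) : PMF β :=
  (PMF.uniformOfFintype (Fin (A.draws a) → Fin (A.bound a + 1))).map
    fun ω => A.run a (List.ofFn fun i => (ω i : ℕ))

open Classical in
/-- A graph on `{0, …, n - 1}` written as its adjacency matrix, row by row. -/
noncomputable def graphCode {n : ℕ} (G : SimpleGraph (Fin n)) : List (List Bool) :=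
  List.ofFn fun i => List.ofFn fun j => decide (G.Adj i j)

/-- The input of the compression: the graph and the list of its terminals. -/
noncomputable def inputCode {n k : ℕ} (G : SimpleGraph (Fin n)) (q : Fin k ↪ Fin n) :
    List (List Bool) × List ℕ :=
  (graphCode G, List.ofFn fun i => (q i : ℕ))

/-- A randomized sketching scheme. The compression algorithm reads a graph with its terminals and
outputs a sketch, which is a list of machine words. The extraction algorithm reads a query and a
sketch, and nothing else. -/
structure SketchingScheme where
  compress : RandomizedAlgorithm (List (List Bool) × List ℕ) (List ℕ)
  extract : RandomizedAlgorithm (List (List Bool) × List ℕ) ℕ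

namespace SketchingScheme

/-- The graph `G^Q`. The query `Q` is a set of edges between the terminals `q 0, …, q (k - 1)`,
that is, a graph on the indices of the terminals; it may overlap with the edges of `G`. -/
def queried {n k : ℕ} (G : SimpleGraph (Fin n)) (q : Fin k ↪ Fin n)
    (Q : SimpleGraph (Fin k)) : SimpleGraph (Fin n) :=
  G ⊔ Q.map q

/-- The distribution of the sketch. -/
noncomputable def sketchDist (S : SketchingScheme) {n k : ℕ} (G : SimpleGraph (Fin n))
    (q : Fin k ↪ Fin n) : PMF (List ℕ) :=
  S.compress.dist (inputCode G q)

/-- The distribution of the answer to the query `Q`, over the coins of both algorithms. -/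
noncomputable def answerDist (S : SketchingScheme) {n k : ℕ} (G : SimpleGraph (Fin n))
    (q : Fin k ↪ Fin n) (Q : SimpleGraph (Fin k)) : PMF ℕ :=
  (S.sketchDist G q).bind fun Γ => S.extract.dist (graphCode Q, Γ)

/-- `S` is a `k`-dynamic sketching scheme for the problem `P` that answers any query correctly
with probability at least `1 - δ`. -/
def Answers (S : SketchingScheme) (k : ℕ) (P : ∀ {n : ℕ}, SimpleGraph (Fin n) → ℕ)
    (δ : ℝ) : Prop :=
  ∀ (n : ℕ) (G : SimpleGraph (Fin n)) (q : Fin k ↪ Fin n) (Q : SimpleGraph (Fin k)),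
    ENNReal.ofReal (1 - δ) ≤ S.answerDist G q Q (P (queried G q Q))

/-- With `k` terminals, every sketch that `S` can output for an `n`-vertex graph consists of at
most `s` machine words. A machine word has `Nat.size n = ⌊log₂ n⌋ + 1` bits. -/
def HasSize (S : SketchingScheme) (k : ℕ) (s : ℝ) : Prop :=
  ∀ (n : ℕ) (G : SimpleGraph (Fin n)) (q : Fin k ↪ Fin n), ∀ Γ ∈ (S.sketchDist G q).support,
    (∀ w ∈ Γ, w < 2 ^ Nat.size n) ∧ (Γ.length : ℝ) ≤ s

end SketchingScheme

/-! ### The sketch obtained from the Tutte matrix -/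

open Classical in
/-- The Tutte matrix of `G`, with the variable of the edge `{i, j}`, `i < j`, evaluated at
`x i j`. -/
noncomputable def tutteMatrix {m : ℕ} {R : Type*} [Ring R] (G : SimpleGraph (Fin m))
    (x : Fin m → Fin m → R) : Matrix (Fin m) (Fin m) R :=
  Matrix.of fun i j => if G.Adj i j then (if i < j then x i j else -x j i) else 0

/-- The data of the sketch: the number `r` and four `k × k` matrices over `ℤ/p`. -/
structure TutteSketch (p k : ℕ) where
  r : ℕ
  Ahat : Matrix (Fin k) (Fin k) (ZMod p)
  A1 : Matrix (Fin k) (Fin k) (ZMod p)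
  B2 : Matrix (Fin k) (Fin k) (ZMod p)
  C2 : Matrix (Fin k) (Fin k) (ZMod p)

namespace TutteSketch

/-- The `2k × 2k` matrix `M̂` of the query `Q`: its upper left block is the Tutte matrix of `Q`
evaluated at the stored numbers `Ahat`, plus `A1`. -/
noncomputable def Mhat {p k : ℕ} (s : TutteSketch p k) (Q : SimpleGraph (Fin k)) :
    Matrix (Fin k ⊕ Fin k) (Fin k ⊕ Fin k) (ZMod p) :=
  Matrix.fromBlocks (tutteMatrix Q s.Ahat + s.A1) s.B2 s.C2 0

/-- The answer `(rank M̂ + r) / 2`. -/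
noncomputable def answer {p k : ℕ} (s : TutteSketch p k) (Q : SimpleGraph (Fin k)) : ℕ :=
  ((s.Mhat Q).rank + s.r) / 2

end TutteSketch

/-- The columns of the `k × k` matrix `N` are distinct columns of `B`, including a maximal linearly
independent set of them. If `B` has fewer than `k` columns, all are taken and the rest of `N` is
filled up with zeros. -/
def PicksColumns {k : ℕ} {W F : Type*} [Field F] (B : Matrix (Fin k) W F)
    (N : Matrix (Fin k) (Fin k) F) : Prop :=
  ∃ c : Fin k → Option W,
    (∀ s t w, c s = some w → c t = some w → s = t) ∧
    ((∀ t, c t ≠ none) ∨ ∀ w, ∃ t, c t = some w) ∧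
    (∀ i t, N i t = (c t).elim 0 fun w => B i w) ∧
    Submodule.span F (Set.range N.col) = Submodule.span F (Set.range B.col)

/-- The sketch `s` is obtained from the Tutte matrix of `G` evaluated at `x`, written in blocks
`[A₀, B; C, D]` with the terminals first, and from the numbers `a`. Invertible row operations `R` and
column operations `S` turn `D` into a diagonal matrix with ones in the positions `J` and zeros
elsewhere. The columns `X` of `B * S` and the rows `Y` of `R * C` with index in `J` are eliminated,
which turns `A₀` into `A1 = A₀ - X * Y`. From the other columns and rows, `k` are picked. -/
def IsTutteSketch {p n k : ℕ} [Fact p.Prime] (G : SimpleGraph (Fin n)) (q : Fin k ↪ Fin n)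
    (x : Fin n → Fin n → ZMod p) (a : Fin k → Fin k → ZMod p) (s : TutteSketch p k) : Prop :=
  let nonTerminal : {v : Fin n // ∀ i, q i ≠ v} → Fin n := Subtype.val
  let M := tutteMatrix G x
  let A₀ := M.submatrix q q
  let B := M.submatrix q nonTerminal
  let C := M.submatrix nonTerminal q
  let D := M.submatrix nonTerminal nonTerminal
  s.r = D.rank ∧
  s.Ahat = Matrix.of a ∧
  ∃ (R S : Matrix {v : Fin n // ∀ i, q i ≠ v} {v : Fin n // ∀ i, q i ≠ v} (ZMod p))
    (J : Finset {v : Fin n // ∀ i, q i ≠ v}),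
    IsUnit R ∧ IsUnit S ∧
    R * D * S = Matrix.diagonal (fun u => if u ∈ J then 1 else 0) ∧
    (let X := (B * S).submatrix id (fun u : {u // u ∈ J} => u.1)
     let Y := (R * C).submatrix (fun u : {u // u ∈ J} => u.1) id
     let B₁ := (B * S).submatrix id (fun u : {u // u ∉ J} => u.1)
     let C₁ := (R * C).submatrix (fun u : {u // u ∉ J} => u.1) id
     s.A1 = A₀ - X * Y ∧ PicksColumns B₁ s.B2 ∧ PicksColumns C₁.transpose s.C2.transpose)

/-- With `k` terminals, the scheme `S` works as follows on `n`-vertex graphs, with the prime `p n`: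
the compression evaluates the Tutte matrix of `G` at independent uniform elements of `ℤ/p`, draws
`k²` more of them, and stores (through an injective encoding) a sketch that arises from them by row
and column operations; the extraction returns `(rank M̂ + r) / 2`. -/
def SketchingScheme.StoresTutteSketch (S : SketchingScheme) (k : ℕ) (p : ℕ → ℕ)
    [∀ n, Fact (p n).Prime] : Prop :=
  ∃ encode : ∀ n, TutteSketch (p n) k → List ℕ,
    (∀ n, Set.InjOn (encode n) {s | s.r ≤ n}) ∧
    (∀ (n : ℕ) (G : SimpleGraph (Fin n)) (q : Fin k ↪ Fin n),
      ∃ sketch : (Fin n → Fin n → ZMod (p n)) → (Fin k → Fin k → ZMod (p n)) →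
          TutteSketch (p n) k,
        (∀ x a, IsTutteSketch G q x a (sketch x a)) ∧
        S.sketchDist G q =
          (PMF.uniformOfFintype
            ((Fin n → Fin n → ZMod (p n)) × (Fin k → Fin k → ZMod (p n)))).map
              fun ω => encode n (sketch ω.1 ω.2)) ∧
    (∀ (n : ℕ) (s : TutteSketch (p n) k) (Q : SimpleGraph (Fin k)), k ≤ n → s.r ≤ n →
      S.extract.dist (graphCode Q, encode n s) = PMF.pure (s.answer Q))

/-! Let `T` be the evaluated Tutte matrix of the queried graph, in which an edge of both `G` and `Q`
carries a sum of two variables. The rank of `T` determines the matching number `ν` with high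
probability, and this rank can be recovered from `O(k²)` field elements.

For every evaluation, `rank T ≤ 2ν`: an alternating matrix has a nonsingular principal submatrix
whose order is the rank (`Matrix.IsSkewOn.exists_nonsingularOn`), and the vertices of a nonsingular
principal submatrix are perfectly matched along nonzero entries
(`Matrix.IsSkewOn.exists_matching_of_nonsingularOn`). Conversely, setting the variables to the
indicator of a maximum matching makes the principal minor on its `2ν ≤ n` vertices nonzero. This
minor is therefore a nonzero polynomial of degree at most `n`, and by Schwartz–Zippel
(`card_rank_ne_mul_le`) equality fails for at most a fraction `n/p ≤ δ` of the evaluations.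

A query changes only the terminal block. Diagonalizing `D` and taking a Schur complement splits `r`
off the rank; of the remaining border only the column space of `B'` and the row space of `C'`
matter, and these have dimension at most `k`. Hence `IsTutteSketch.rank_add`: `rank M̂ + r = rank T`
for every evaluation, so the sketch introduces no error of its own.

Both algorithms must be total recursive. Instead of eliminating, they search for a certificate:
transformation matrices with their inverses, pivot flags, chosen columns and rows, and coefficients.
Checking is primitive recursive, a certificate exists for every input, and any certificate gives a
valid sketch or the correct rank. The arithmetic is on natural numbers; `castMat` translates it to
`ZMod p`.

Finally `p ≤ b ^ L`, where `b` is the base of the words and `L` is of order `max 1 (log (1/δ))`,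
independent of `n`. So `L` words per entry suffice. -/

/-! ### Alternating matrices and matchings. -/

theorem SimpleGraph.Subgraph.IsMatching.ncard_verts {V : Type*} [Finite V] {G : SimpleGraph V}
    {M : G.Subgraph} (h : M.IsMatching) : M.verts.ncard = 2 * M.edgeSet.ncard := by
  classical
  have := Fintype.ofFinite V
  have h1 := M.spanningCoe.sum_degrees_eq_twice_card_edges
  have h2 : ∀ v, M.spanningCoe.degree v = if v ∈ M.verts then 1 else 0 := by
    intro v
    rw [SimpleGraph.Subgraph.degree_spanningCoe]
    split_ifs with hv
    · exact (SimpleGraph.Subgraph.isMatching_iff_forall_degree.1 h) v hv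
    · exact M.degree_of_notMem_verts hv
  simp only [h2] at h1
  rw [Finset.sum_ite, Finset.sum_const_zero, add_zero, Finset.sum_const, smul_eq_mul, mul_one] at h1
  rw [Set.ncard_eq_toFinset_card', Set.ncard_eq_toFinset_card', ← Set.filter_mem_univ_eq_toFinset]
  convert h1 using 2
  rw [SimpleGraph.edgeFinset]
  congr 1
  ext e
  simp

/-- The principal submatrix of `A` on the rows and columns in `I` is nonsingular. -/
def Matrix.NonsingularOn {V F : Type*} [Fintype V] [Field F] (A : Matrix V V F)
    (I : Finset V) : Prop :=
  ∀ v : V → F, (∀ i, i ∉ I → v i = 0) → (∀ i ∈ I, A.mulVec v i = 0) → v = 0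

/-- The matrix `A` is alternating and vanishes outside the edges of `H`. -/
structure Matrix.IsSkewOn {V F : Type*} [Field F] (A : Matrix V V F) (H : SimpleGraph V) :
    Prop where
  neg : ∀ i j, A i j = -A j i
  adj : ∀ i j, A i j ≠ 0 → H.Adj i j

namespace Matrix

variable {V F : Type*} [Fintype V] [Field F] {A : Matrix V V F} {H : SimpleGraph V}

theorem mulVec_extend_zero [DecidableEq V] (A : Matrix V V F) (I : Finset V) (u : I → F) (i : I) :
    A.mulVec (fun j => if hj : j ∈ I then u ⟨j, hj⟩ else 0) i =
      (A.submatrix (Subtype.val : I → V) (Subtype.val : I → V)).mulVec u i := by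
  simp only [mulVec, dotProduct]
  rw [← Finset.sum_subset (Finset.subset_univ I), ← Finset.sum_attach]
  · exact Finset.sum_congr rfl fun j _ => by simp
  · intro j _ hj
    simp [hj]

theorem NonsingularOn.det_ne_zero [DecidableEq V] {I : Finset V} (h : A.NonsingularOn I) :
    (A.submatrix (Subtype.val : I → V) (Subtype.val : I → V)).det ≠ 0 := by
  intro hdet
  obtain ⟨u, hu0, hu⟩ := exists_mulVec_eq_zero_iff.2 hdet
  refine hu0 ?_
  have := h (fun j => if hj : j ∈ I then u ⟨j, hj⟩ else 0) (fun i hi => by simp [hi])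
    fun i hi => by
      rw [mulVec_extend_zero A I u ⟨i, hi⟩, hu]
      rfl
  funext i
  simpa using congrFun this i

theorem NonsingularOn.exists_mulVec [DecidableEq V] {I : Finset V} (h : A.NonsingularOn I)
    (y : V → F) : ∃ w : V → F, (∀ i, i ∉ I → w i = 0) ∧ ∀ i ∈ I, A.mulVec w i = y i := by
  obtain ⟨u, hu⟩ := mulVec_surjective_iff_isUnit.2
    ((isUnit_iff_isUnit_det _).2 (isUnit_iff_ne_zero.2 h.det_ne_zero)) fun i : I => y i
  exact ⟨fun j => if hj : j ∈ I then u ⟨j, hj⟩ else 0, fun i hi => by simp [hi], fun i hi => by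
    rw [mulVec_extend_zero A I u ⟨i, hi⟩]; exact congrFun hu ⟨i, hi⟩⟩

theorem IsSkewOn.dotProduct_mulVec (hA : A.IsSkewOn H) (v w : V → F) :
    v ⬝ᵥ A.mulVec w = -(A.mulVec v ⬝ᵥ w) := by
  have : Aᵀ = -A := by
    ext i j
    simpa using hA.neg j i
  rw [Matrix.dotProduct_mulVec, ← mulVec_transpose, this, neg_mulVec, neg_dotProduct]

/-- The terms `(i, j)` and `(j, i)` cancel, and the diagonal terms vanish because `H` has no loops.
Nothing is divided by 2, so characteristic 2 is allowed. -/
theorem IsSkewOn.dotProduct_mulVec_self (hA : A.IsSkewOn H) (v : V → F) :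
    v ⬝ᵥ A.mulVec v = 0 := by
  classical
  simp only [dotProduct, mulVec, Finset.mul_sum, ← Finset.sum_product']
  refine Finset.sum_involution (fun z _ => (z.2, z.1)) ?_ ?_ ?_ ?_
  · intro z _
    simp only
    rw [hA.neg z.2 z.1]
    ring
  · intro z _ hz hz'
    have : z.1 = z.2 := (congrArg Prod.snd hz')
    rw [this] at hz
    exact H.loopless.irrefl _ (hA.adj z.2 z.2 fun h => hz (by rw [h]; ring))
  · simp
  · simp

/-- Induction that removes one matched pair at a time, without Pfaffians. For `i` in `I` take `w`
supported on `I` with `A w = e_i` on `I`. Row `i` gives a `j` with `A i j ≠ 0` and `w j ≠ 0`; the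
edge `ij` is matched, and `A` stays nonsingular on the rest. -/
theorem IsSkewOn.exists_matching_of_nonsingularOn [DecidableEq V] (hA : A.IsSkewOn H) :
    ∀ I : Finset V, A.NonsingularOn I → ∃ M : H.Subgraph, M.IsMatching ∧ M.verts = I := by
  intro I
  induction I using Finset.strongInduction with
  | H I ih =>
  intro hI
  rcases I.eq_empty_or_nonempty with rfl | ⟨i, hi⟩
  · exact ⟨⊥, by simp [SimpleGraph.Subgraph.IsMatching], by simp⟩
  obtain ⟨w, hw0, hw⟩ := hI.exists_mulVec (Pi.single i 1)
  have hdot : ∀ v : V → F, (∀ j, j ∉ I → v j = 0) → A.mulVec w ⬝ᵥ v = v i := by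
    intro v hv
    rw [dotProduct, ← Finset.sum_subset (Finset.subset_univ I),
      Finset.sum_congr rfl (fun j hj => by rw [hw j hj])]
    · simp [Pi.single_apply, hi]
    · intro j _ hj
      simp [hv j hj]
  have hwi : w i = 0 := by
    rw [← hdot w hw0, dotProduct_comm, hA.dotProduct_mulVec_self]
  have hAw : A.mulVec w i ≠ 0 := by simp [hw i hi]
  obtain ⟨j, -, hj⟩ := Finset.exists_ne_zero_of_sum_ne_zero hAw
  have hAij : A i j ≠ 0 := left_ne_zero_of_mul hj
  have hwj : w j ≠ 0 := right_ne_zero_of_mul hj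
  have hjI : j ∈ I := by_contra fun h => hwj (hw0 j h)
  have hadj := hA.adj i j hAij
  have hij : i ≠ j := hadj.ne
  have hsub : (I.erase i).erase j ⊂ I :=
    ((Finset.erase_subset _ _).trans_ssubset (Finset.erase_ssubset hi))
  -- Let `v` be supported on the smaller set and `A v = 0` there. Evaluating `w ⬝ᵥ A v` in two ways
  -- gives `(A v) j = 0`, since `w i = 0` and `w j ≠ 0`.
  obtain ⟨M, hM, hMv⟩ := ih _ hsub (by
    intro v hv0 hv
    have hvI : ∀ l, l ∉ I → v l = 0 := fun l hl => hv0 l (by simp [hl])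
    have hvi : v i = 0 := hv0 i (by simp)
    have hvj : v j = 0 := hv0 j (by simp)
    have h1 : w ⬝ᵥ A.mulVec v = 0 := by
      rw [hA.dotProduct_mulVec, hdot v hvI, hvi, neg_zero]
    have h2 : w ⬝ᵥ A.mulVec v = w j * A.mulVec v j := by
      rw [dotProduct, Finset.sum_eq_single j]
      · intro l _ hl
        by_cases hlI : l ∈ I
        · by_cases hli : l = i
          · rw [hli, hwi, zero_mul]
          · rw [hv l (by simp [hl, hli, hlI]), mul_zero]
        · rw [hw0 l hlI, zero_mul]
      · simp
    have h3 : A.mulVec v j = 0 := by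
      rw [h1] at h2
      exact (mul_eq_zero.1 h2.symm).resolve_left hwj
    -- Subtracting this multiple of `w` also annihilates row `i`. The resulting vector is zero, and
    -- its coordinate `j` shows that the multiple was zero.
    have h4 := hI (v - A.mulVec v i • w) (fun l hl => by simp [hvI l hl, hw0 l hl]) (by
      intro l hl
      rw [mulVec_sub, mulVec_smul, Pi.sub_apply, Pi.smul_apply, hw l hl]
      by_cases hli : l = i
      · simp [hli]
      · rw [Pi.single_eq_of_ne hli, smul_zero, sub_zero]
        by_cases hlj : l = j
        · rw [hlj, h3]
        · exact hv l (by simp [hlj, hli, hl]))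
    have h5 : A.mulVec v i = 0 := by
      have := congrFun h4 j
      simp only [Pi.sub_apply, Pi.smul_apply, hvj, smul_eq_mul, Pi.zero_apply, zero_sub,
        neg_eq_zero, mul_eq_zero] at this
      exact this.resolve_right hwj
    rwa [h5, zero_smul, sub_zero] at h4)
  have hdisj : Disjoint M.support (H.subgraphOfAdj hadj).support := by
    rw [hM.support_eq_verts, (SimpleGraph.Subgraph.IsMatching.subgraphOfAdj hadj).support_eq_verts,
      hMv]
    rw [Set.disjoint_left]
    intro l hl hl'
    simp only [SimpleGraph.subgraphOfAdj_verts, Set.mem_insert_iff, Set.mem_singleton_iff] at hl'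
    rcases hl' with rfl | rfl <;> simp at hl
  refine ⟨M ⊔ H.subgraphOfAdj hadj,
    hM.sup (SimpleGraph.Subgraph.IsMatching.subgraphOfAdj hadj) hdisj, ?_⟩
  rw [SimpleGraph.Subgraph.verts_sup, hMv]
  ext l
  simp only [Finset.coe_erase, SimpleGraph.subgraphOfAdj_verts, Set.mem_union, Set.mem_sdiff,
    Finset.mem_coe, Set.mem_singleton_iff, Set.mem_insert_iff]
  constructor
  · rintro (h | rfl | rfl)
    exacts [h.1.1, hi, hjI]
  · intro h
    tauto

/-- Take `I` to index a basis of the row space. If `v` is supported on `I` and `A v` vanishes on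
`I`, then `A v = 0`, since all rows are combinations of those in `I`. -/
theorem IsSkewOn.exists_nonsingularOn [DecidableEq V] (hA : A.IsSkewOn H) :
    ∃ I : Finset V, A.NonsingularOn I ∧ I.card = A.rank := by
  obtain ⟨κ, a, ha, hspan, hli⟩ := exists_linearIndependent' F A.row
  have := Finite.of_injective a ha
  have := Fintype.ofFinite κ
  refine ⟨Finset.univ.map ⟨a, ha⟩, ?_, ?_⟩
  · intro v hv0 hv
    have hall : ∀ j, A.mulVec v j = 0 := by
      intro j
      have hj : A.row j ∈ Submodule.span F (Set.range (A.row ∘ a)) := by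
        rw [hspan]
        exact Submodule.subset_span ⟨j, rfl⟩
      change A.row j ⬝ᵥ v = 0
      generalize A.row j = x at hj
      induction hj using Submodule.span_induction with
      | mem x hx =>
        obtain ⟨c, rfl⟩ := hx
        exact hv (a c) (by simp)
      | zero => simp
      | add x y _ _ hx hy => rw [add_dotProduct, hx, hy, add_zero]
      | smul t x _ hx => rw [smul_dotProduct, hx, smul_zero]
    -- By skew-symmetry the column relation `A v = 0` is a relation between the independent rows.
    have hcomb : ∑ c, v (a c) • (A.row ∘ a) c = 0 := by
      funext j
      rw [Finset.sum_apply]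
      have h1 : A.mulVec v j = ∑ c, A j (a c) * v (a c) := by
        rw [mulVec, dotProduct, ← Finset.sum_subset
          (Finset.subset_univ (Finset.univ.map ⟨a, ha⟩)), Finset.sum_map]
        · rfl
        · intro i _ hi
          rw [hv0 i hi, mul_zero]
      rw [hall j] at h1
      rw [Pi.zero_apply, ← neg_zero, h1, ← Finset.sum_neg_distrib]
      refine Finset.sum_congr rfl fun c _ => ?_
      change v (a c) * A (a c) j = _
      rw [hA.neg (a c) j]
      ring
    funext i
    by_cases hi : i ∈ Finset.univ.map ⟨a, ha⟩
    · obtain ⟨c, -, rfl⟩ := Finset.mem_map.1 hi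
      exact Fintype.linearIndependent_iff.1 hli _ hcomb c
    · exact hv0 i hi
  · rw [Finset.card_map, Finset.card_univ, rank_eq_finrank_span_row, ← hspan]
    exact (finrank_span_eq_card hli).symm

end Matrix

theorem bddAbove_matchingSizes {n : ℕ} (G : SimpleGraph (Fin n)) :
    BddAbove {m : ℕ | ∃ M : G.Subgraph, M.IsMatching ∧ M.edgeSet.ncard = m} := by
  refine ⟨n, ?_⟩
  rintro _ ⟨M, hM, rfl⟩
  have h1 := hM.ncard_verts
  have h2 := Set.ncard_le_card M.verts
  simp only [Nat.card_eq_fintype_card, Fintype.card_fin] at h2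
  omega

theorem exists_isMatching_matchingNumber {n : ℕ} (G : SimpleGraph (Fin n)) :
    ∃ M : G.Subgraph, M.IsMatching ∧ M.edgeSet.ncard = matchingNumber G :=
  Nat.sSup_mem (s := {m : ℕ | ∃ M : G.Subgraph, M.IsMatching ∧ M.edgeSet.ncard = m})
    ⟨0, ⊥, by simp [SimpleGraph.Subgraph.IsMatching], by simp⟩ (bddAbove_matchingSizes G)

theorem Matrix.IsSkewOn.rank_le_two_mul_matchingNumber {n : ℕ} {F : Type*} [Field F] {A : Matrix (Fin n) (Fin n) F}
    {H : SimpleGraph (Fin n)} (hA : A.IsSkewOn H) :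
    A.rank ≤ 2 * matchingNumber H := by
  obtain ⟨I, hI, hcard⟩ := hA.exists_nonsingularOn
  obtain ⟨M, hM, hMv⟩ := hA.exists_matching_of_nonsingularOn I hI
  have h1 := hM.ncard_verts
  rw [hMv, Set.ncard_coe_finset, hcard] at h1
  have h2 : M.edgeSet.ncard ≤ matchingNumber H :=
    le_csSup (bddAbove_matchingSizes H) ⟨M, hM, rfl⟩
  omega

/-! ### Tutte matrices of a graph and of a queried graph. -/

theorem tutteMatrix_neg {m : ℕ} {R : Type*} [Ring R] (G : SimpleGraph (Fin m))
    (x : Fin m → Fin m → R) (i j : Fin m) :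
    tutteMatrix G x i j = -tutteMatrix G x j i := by
  simp only [tutteMatrix, Matrix.of_apply]
  by_cases h : G.Adj i j
  · rcases lt_or_gt_of_ne h.ne with h' | h'
    · simp [h, h.symm, h', h'.not_gt]
    · simp [h, h.symm, h', h'.not_gt]
  · have h' : ¬G.Adj j i := fun h' => h h'.symm
    simp [h, h']

theorem tutteMatrix_of_not_adj {m : ℕ} {R : Type*} [Ring R] {G : SimpleGraph (Fin m)}
    (x : Fin m → Fin m → R) {i j : Fin m} (h : ¬G.Adj i j) : tutteMatrix G x i j = 0 := by
  simp [tutteMatrix, h]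

theorem tutteMatrix_map {m : ℕ} {R S : Type*} [Ring R] [Ring S] (G : SimpleGraph (Fin m))
    (x : Fin m → Fin m → R) (f : R →+* S) (i j : Fin m) :
    f (tutteMatrix G x i j) = tutteMatrix G (fun i j => f (x i j)) i j := by
  simp only [tutteMatrix, Matrix.of_apply]
  split_ifs <;> simp

theorem tutteMatrix_eq_or {m : ℕ} {R : Type*} [Ring R] (G : SimpleGraph (Fin m))
    (x : Fin m → Fin m → R) (i j : Fin m) :
    tutteMatrix G x i j = 0 ∨ tutteMatrix G x i j = x i j ∨ tutteMatrix G x i j = -x j i := by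
  simp only [tutteMatrix, Matrix.of_apply]
  split_ifs <;> simp

/-- The Tutte matrix of the graph `G^Q`, where an edge contributes a summand for `G` and a summand
for `Q`. -/
noncomputable def queriedTutteMatrix {n k : ℕ} {R : Type*} [Ring R] (G : SimpleGraph (Fin n))
    (q : Fin k ↪ Fin n) (Q : SimpleGraph (Fin k)) (x : Fin n → Fin n → R)
    (a : Fin k → Fin k → R) : Matrix (Fin n) (Fin n) R :=
  Matrix.of fun u v => tutteMatrix G x u v +
    ∑ i, ∑ j, if q i = u ∧ q j = v then tutteMatrix Q a i j else 0

section QueriedTutteMatrix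

variable {n k : ℕ} {R : Type*} [Ring R] (G : SimpleGraph (Fin n))
  (q : Fin k ↪ Fin n) (Q : SimpleGraph (Fin k)) (x : Fin n → Fin n → R) (a : Fin k → Fin k → R)

theorem queriedTutteMatrix_terminal (i j : Fin k) :
    queriedTutteMatrix G q Q x a (q i) (q j) =
      tutteMatrix G x (q i) (q j) + tutteMatrix Q a i j := by
  simp [queriedTutteMatrix, ite_and]

theorem queriedTutteMatrix_of_left {u : Fin n} (hu : ∀ i, q i ≠ u) (v : Fin n) :
    queriedTutteMatrix G q Q x a u v = tutteMatrix G x u v := by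
  simp [queriedTutteMatrix, hu]

theorem queriedTutteMatrix_of_right (u : Fin n) {v : Fin n} (hv : ∀ i, q i ≠ v) :
    queriedTutteMatrix G q Q x a u v = tutteMatrix G x u v := by
  simp [queriedTutteMatrix, hv]

theorem queriedTutteMatrix_cases (u v : Fin n) :
    queriedTutteMatrix G q Q x a u v = tutteMatrix G x u v ∨ ∃ i j, u = q i ∧ v = q j := by
  by_cases hu : ∀ i, q i ≠ u
  · exact .inl (queriedTutteMatrix_of_left G q Q x a hu v)
  by_cases hv : ∀ i, q i ≠ v
  · exact .inl (queriedTutteMatrix_of_right G q Q x a u hv)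
  push Not at hu hv
  obtain ⟨i, rfl⟩ := hu
  obtain ⟨j, rfl⟩ := hv
  exact .inr ⟨i, j, rfl, rfl⟩

theorem queriedTutteMatrix_map {S : Type*} [Ring S] (f : R →+* S) :
    (queriedTutteMatrix G q Q x a).map f =
      queriedTutteMatrix G q Q (fun i j => f (x i j)) fun i j => f (a i j) := by
  ext u v
  simp only [queriedTutteMatrix, Matrix.map_apply, Matrix.of_apply, map_add, map_sum,
    apply_ite f, map_zero, tutteMatrix_map]

theorem queried_adj {u v : Fin n} : (SketchingScheme.queried G q Q).Adj u v ↔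
    G.Adj u v ∨ ∃ i j, Q.Adj i j ∧ q i = u ∧ q j = v := by
  simp [SketchingScheme.queried, SimpleGraph.map_adj]

end QueriedTutteMatrix

section Generic

variable {n k : ℕ} {F : Type*} [Field F] (G : SimpleGraph (Fin n))
  (q : Fin k ↪ Fin n) (Q : SimpleGraph (Fin k))

theorem isSkewOn_queriedTutteMatrix (x : Fin n → Fin n → F) (a : Fin k → Fin k → F) :
    (queriedTutteMatrix G q Q x a).IsSkewOn (SketchingScheme.queried G q Q) where
  neg u v := by
    by_cases hu : ∀ i, q i ≠ u
    · rw [queriedTutteMatrix_of_left _ _ _ _ _ hu, queriedTutteMatrix_of_right _ _ _ _ _ _ hu,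
        tutteMatrix_neg]
    by_cases hv : ∀ i, q i ≠ v
    · rw [queriedTutteMatrix_of_left _ _ _ _ _ hv, queriedTutteMatrix_of_right _ _ _ _ _ _ hv,
        tutteMatrix_neg]
    push Not at hu hv
    obtain ⟨i, rfl⟩ := hu
    obtain ⟨j, rfl⟩ := hv
    rw [queriedTutteMatrix_terminal, queriedTutteMatrix_terminal, tutteMatrix_neg G,
      tutteMatrix_neg Q]
    ring
  adj u v h := by
    rw [queried_adj]
    by_contra! hn
    obtain ⟨h1, h2⟩ := hn
    refine h ?_
    rcases queriedTutteMatrix_cases G q Q x a u v with h' | ⟨i, j, rfl, rfl⟩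
    · rw [h', tutteMatrix_of_not_adj _ h1]
    · rw [queriedTutteMatrix_terminal, tutteMatrix_of_not_adj _ h1, zero_add]
      exact tutteMatrix_of_not_adj _ fun h' => h2 i j h' rfl rfl

/-- With the variables set to the indicator of `M`, the nonzero entries sit exactly at the edges of
`M`, one in each row of `I`. -/
theorem exists_nonsingularOn_of_isMatching
    {M : (SketchingScheme.queried G q Q).Subgraph} (hM : M.IsMatching) (I : Finset (Fin n))
    (hI : M.verts = I) : ∃ (x : Fin n → Fin n → F) (a : Fin k → Fin k → F),
      (queriedTutteMatrix G q Q x a).NonsingularOn I := by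
  classical
  let x : Fin n → Fin n → F := fun i j => if M.Adj i j then 1 else 0
  -- An edge of `G` is switched on through `x` alone: two summands could cancel, since `q` need not
  -- preserve the order that fixes the signs.
  let a : Fin k → Fin k → F := fun i j => if M.Adj (q i) (q j) ∧ ¬G.Adj (q i) (q j) then 1 else 0
  have hzero : ∀ u v, ¬M.Adj u v → queriedTutteMatrix G q Q x a u v = 0 := by
    intro u v h
    have h' : ¬M.Adj v u := fun h' => h h'.symm
    have h1 : tutteMatrix G x u v = 0 := by
      rcases tutteMatrix_eq_or G x u v with h1 | h1 | h1 <;> simp [h1, x, h, h']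
    rcases queriedTutteMatrix_cases G q Q x a u v with h2 | ⟨i, j, rfl, rfl⟩
    · rw [h2, h1]
    · rw [queriedTutteMatrix_terminal, h1, zero_add]
      rcases tutteMatrix_eq_or Q a i j with h1 | h1 | h1 <;> simp [h1, a, h, h']
  have hne : ∀ u v, M.Adj u v → queriedTutteMatrix G q Q x a u v ≠ 0 := by
    intro u v h
    by_cases hG : G.Adj u v
    · have h1 : tutteMatrix G x u v ≠ 0 := by
        simp only [tutteMatrix, Matrix.of_apply, hG, if_true, x, h, h.symm]
        split_ifs <;> simp
      rcases queriedTutteMatrix_cases G q Q x a u v with h2 | ⟨i, j, rfl, rfl⟩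
      · rwa [h2]
      · rw [queriedTutteMatrix_terminal]
        rcases tutteMatrix_eq_or Q a i j with h2 | h2 | h2 <;>
          simpa [h2, a, hG, hG.symm] using h1
    · obtain ⟨i, j, hQ, rfl, rfl⟩ := ((queried_adj G q Q).1 (M.adj_sub h)).resolve_left hG
      have hG' : ¬G.Adj (q j) (q i) := fun h' => hG h'.symm
      rw [queriedTutteMatrix_terminal, tutteMatrix_of_not_adj _ hG, zero_add]
      simp only [tutteMatrix, Matrix.of_apply, hQ, if_true, a, h, h.symm, hG, hG',
        not_false_eq_true, and_self]
      split_ifs <;> simp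
  refine ⟨x, a, fun w hw0 hw => funext fun i => ?_⟩
  by_cases hi : i ∈ I
  · obtain ⟨j, hij, -⟩ := hM (v := i) (by rw [hI]; exact hi)
    have hj : j ∈ I := by
      have := M.edge_vert hij.symm
      rwa [hI] at this
    -- The row of the partner `j` has its only nonzero entry in column `i`, so it isolates `w i`.
    have := hw j hj
    rw [Matrix.mulVec, dotProduct, Finset.sum_eq_single i] at this
    · exact (mul_eq_zero.1 this).resolve_left (hne j i hij.symm)
    · intro l _ hl
      rw [hzero j l, zero_mul]
      exact fun h => hl (hM.eq_of_adj_left h hij.symm)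
    · simp
  · exact hw0 i hi

end Generic

/-! ### The Schwartz–Zippel bound for the rank. -/

theorem MvPolynomial.totalDegree_det_le {σ R I : Type*} [CommRing R] [Nontrivial R] [Fintype I]
    [DecidableEq I] (N : Matrix I I (MvPolynomial σ R)) (h : ∀ i j, (N i j).totalDegree ≤ 1) :
    N.det.totalDegree ≤ Fintype.card I := by
  rw [Matrix.det_apply]
  refine totalDegree_finsetSum_le fun τ _ => ?_
  refine (totalDegree_smul_le _ _).trans ?_
  refine (totalDegree_finsetProd _ _).trans ?_
  refine (Finset.sum_le_sum fun i _ => h _ _).trans ?_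
  simp

/-- Schwartz–Zippel over the whole field, with denominators cleared and the variables renumbered by
an initial segment of the naturals. -/
theorem MvPolynomial.card_zeros_mul_le {σ F : Type*} [Fintype σ] [Field F] [Fintype F]
    [DecidableEq F] [DecidableEq σ] {P : MvPolynomial σ F} (hP : P ≠ 0) :
    (Finset.univ.filter fun z : σ → F => eval z P = 0).card * Fintype.card F ≤
      P.totalDegree * Fintype.card (σ → F) := by
  let e := Fintype.equivFin σ
  have hP' : rename e P ≠ 0 := (rename_injective e e.injective).ne_iff' (map_zero _) |>.2 hP
  have h := schwartz_zippel_totalDegree hP' (Finset.univ : Finset F)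
  have hdeg : (rename e P).totalDegree = P.totalDegree := totalDegree_renameEquiv (R := F) e P
  rw [Fintype.piFinset_univ, hdeg] at h
  have hcard : (Finset.univ.filter fun f : Fin (Fintype.card σ) → F => eval f (rename e P) = 0).card
      = (Finset.univ.filter fun z : σ → F => eval z P = 0).card := by
    refine Finset.card_equiv (e.arrowCongr (Equiv.refl F)).symm fun f => ?_
    simp only [Finset.mem_filter, Finset.mem_univ, true_and, eval_rename]
    rfl
  rw [hcard, Finset.card_univ, div_le_div_iff₀ (by positivity) (by positivity)] at h
  rw [Fintype.card_fun]
  exact_mod_cast h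

/-- For all but a fraction of `n / |F|` of the evaluations, the Tutte matrix of `G^Q` has rank twice
the matching number. -/
theorem card_rank_ne_mul_le {n k : ℕ} {F : Type*} [Field F] [Fintype F] [DecidableEq F]
    (G : SimpleGraph (Fin n)) (q : Fin k ↪ Fin n) (Q : SimpleGraph (Fin k)) :
    (Finset.univ.filter fun ω : (Fin n → Fin n → F) × (Fin k → Fin k → F) =>
        (queriedTutteMatrix G q Q ω.1 ω.2).rank ≠
          2 * matchingNumber (SketchingScheme.queried G q Q)).card * Fintype.card F ≤
      n * Fintype.card ((Fin n → Fin n → F) × (Fin k → Fin k → F)) := by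
  classical
  obtain ⟨M, hM, hMcard⟩ := exists_isMatching_matchingNumber (SketchingScheme.queried G q Q)
  let I := M.verts.toFinset
  have hIcard : I.card = 2 * matchingNumber (SketchingScheme.queried G q Q) := by
    rw [← hMcard, ← hM.ncard_verts, Set.ncard_eq_toFinset_card']
  obtain ⟨x, a, hxa⟩ := exists_nonsingularOn_of_isMatching (F := F) G q Q hM I (by simp [I])
  let σ := (Fin n × Fin n) ⊕ (Fin k × Fin k)
  let T : Matrix (Fin n) (Fin n) (MvPolynomial σ F) := queriedTutteMatrix G q Q
    (fun i j => .X (.inl (i, j))) fun i j => .X (.inr (i, j))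
  -- The principal minor of the generic matrix on the vertices covered by a maximum matching; it is
  -- nonzero because its value at `(x, a)` is.
  let P := (T.submatrix (Subtype.val : I → _) (Subtype.val : I → _)).det
  have heval : ∀ z : σ → F, MvPolynomial.eval z P = ((queriedTutteMatrix G q Q
      (fun i j => z (.inl (i, j))) fun i j => z (.inr (i, j))).submatrix
        (Subtype.val : I → _) (Subtype.val : I → _)).det := by
    intro z
    rw [RingHom.map_det, RingHom.mapMatrix_apply, ← Matrix.submatrix_map, queriedTutteMatrix_map]
    simp
  let e : ((Fin n → Fin n → F) × (Fin k → Fin k → F)) ≃ (σ → F) :=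
    ((Equiv.curry _ _ _).symm.prodCongr (Equiv.curry _ _ _).symm).trans
      (Equiv.sumArrowEquivProdArrow _ _ _).symm
  have hP : P ≠ 0 := by
    intro h
    have h1 := heval (e (x, a))
    rw [h, map_zero] at h1
    exact hxa.det_ne_zero h1.symm
  have hdeg : P.totalDegree ≤ n := by
    refine (MvPolynomial.totalDegree_det_le _ fun i j => ?_).trans
      ((Finset.card_le_univ I).trans_eq' (by simp) |>.trans_eq (by simp))
    have htd : ∀ {m : ℕ} (H : SimpleGraph (Fin m)) (y : Fin m → Fin m → MvPolynomial σ F),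
        (∀ i j, (y i j).totalDegree ≤ 1) → ∀ i j, (tutteMatrix H y i j).totalDegree ≤ 1 := by
      intro m H y hy i j
      rcases tutteMatrix_eq_or H y i j with h | h | h
      · simp [h]
      · rw [h]; exact hy _ _
      · rw [h, MvPolynomial.totalDegree_neg]; exact hy _ _
    have h1 := htd G (fun i j => (.X (.inl (i, j)) : MvPolynomial σ F)) (by simp)
    have h2 := htd Q (fun i j => (.X (.inr (i, j)) : MvPolynomial σ F)) (by simp)
    rw [Matrix.submatrix_apply]
    rcases queriedTutteMatrix_cases G q Q (fun i j => (.X (.inl (i, j)) : MvPolynomial σ F))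
      (fun i j => .X (.inr (i, j))) i j with h | ⟨i', j', hi, hj⟩
    · change (T _ _).totalDegree ≤ 1
      simp only [T]
      rw [h]
      exact h1 _ _
    · change (T _ _).totalDegree ≤ 1
      simp only [T]
      rw [hi, hj, queriedTutteMatrix_terminal]
      exact (MvPolynomial.totalDegree_add _ _).trans (max_le (h1 _ _) (h2 _ _))
  have hSZ := MvPolynomial.card_zeros_mul_le hP
  rw [Fintype.card_congr e]
  refine le_trans (Nat.mul_le_mul_right _ ?_) (hSZ.trans (Nat.mul_le_mul_right _ hdeg))
  refine Finset.card_le_card_of_injOn e ?_ e.injective.injOn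
  intro ω hω
  simp only [Finset.coe_filter, Finset.mem_univ, true_and, Set.mem_ofPred_eq] at hω ⊢
  -- Where the minor does not vanish, the rank is at least `I.card = 2ν`, and the upper bound holds
  -- always. So every bad evaluation is a zero of `P`.
  by_contra hne
  rw [heval] at hne
  refine hω (le_antisymm
    (isSkewOn_queriedTutteMatrix G q Q ω.1 ω.2).rank_le_two_mul_matchingNumber ?_)
  rw [← hIcard, ← Fintype.card_coe I, ← Matrix.rank_of_det_ne_zero hne]
  exact Matrix.rank_submatrix_le _ _ _

/-! ### Ranks of bordered matrices. -/

namespace Matrix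

variable {F : Type*} [Field F]

theorem span_range_col_le_iff {m W W' : Type*} [Fintype W'] (B : Matrix m W F)
    (N : Matrix m W' F) :
    Submodule.span F (Set.range B.col) ≤ Submodule.span F (Set.range N.col) ↔
      ∃ Z : Matrix W' W F, B = N * Z := by
  rw [Submodule.span_le, Set.range_subset_iff]
  simp only [SetLike.mem_coe, Submodule.mem_span_range_iff_exists_fun]
  constructor
  · intro h
    choose c hc using h
    refine ⟨Matrix.of fun t w => c w t, ?_⟩
    ext i w
    rw [← col_apply B w i, ← hc w]
    simp [mul_apply, mul_comm]
  · rintro ⟨Z, rfl⟩ w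
    refine ⟨fun t => Z t w, ?_⟩
    ext i
    simp [mul_apply, mul_comm]

/-- Schur complement, through kernels: the block matrix kills exactly the vectors `(x, -C x)` with
`x` in the kernel of `A - B * C`. Rank–nullity then compares the ranks. -/
theorem rank_fromBlocks_one_right {m l J : Type*} [Fintype l] [Fintype J]
    [DecidableEq J] (A : Matrix m l F) (B : Matrix m J F) (C : Matrix J l F) :
    (fromBlocks A B C 1).rank = (A - B * C).rank + Fintype.card J := by
  let φ : (l → F) →ₗ[F] (l ⊕ J → F) :=
    { toFun := fun x => Sum.elim x (-C.mulVec x)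
      map_add' := fun x y => by ext (i | i) <;> simp [mulVec_add, add_comm]
      map_smul' := fun c x => by ext (i | i) <;> simp [mulVec_smul] }
  have hφ : Function.Injective φ := fun x y h => by
    funext i
    exact congrFun h (Sum.inl i)
  have hker : (A - B * C).mulVecLin.ker.map φ = (fromBlocks A B C 1).mulVecLin.ker := by
    ext z
    simp only [Submodule.mem_map, LinearMap.mem_ker, mulVecLin_apply]
    constructor
    · rintro ⟨x, hx, rfl⟩
      change (fromBlocks A B C 1).mulVec (Sum.elim x (-C.mulVec x)) = 0
      rw [sub_mulVec, ← mulVec_mulVec] at hx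
      rw [fromBlocks_mulVec]
      simp only [Sum.elim_comp_inl, Sum.elim_comp_inr, mulVec_neg, ← sub_eq_add_neg, hx,
        one_mulVec, sub_self]
      exact Sum.elim_zero_zero
    · intro hz
      rw [fromBlocks_mulVec] at hz
      have h1 := fun i => congrFun hz (Sum.inl i)
      have h2 : C.mulVec (z ∘ Sum.inl) + z ∘ Sum.inr = 0 := by
        funext i
        simpa using congrFun hz (Sum.inr i)
      have h3 : z ∘ Sum.inr = -C.mulVec (z ∘ Sum.inl) := by
        rw [eq_neg_iff_add_eq_zero, add_comm, h2]
      refine ⟨z ∘ Sum.inl, ?_, ?_⟩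
      · rw [sub_mulVec, ← mulVec_mulVec]
        funext i
        have := h1 i
        simp only [Sum.elim_inl, h3, mulVec_neg, Pi.add_apply, Pi.neg_apply, Pi.zero_apply] at this
        rw [Pi.sub_apply, Pi.zero_apply, sub_eq_add_neg, this]
      · change Sum.elim (z ∘ Sum.inl) (-C.mulVec (z ∘ Sum.inl)) = z
        rw [← h3, Sum.elim_comp_inl_inr]
  have h1 := (A - B * C).mulVecLin.finrank_range_add_finrank_ker
  have h2 := (fromBlocks A B C 1).mulVecLin.finrank_range_add_finrank_ker
  rw [← hker, ← ((A - B * C).mulVecLin.ker.equivMapOfInjective φ hφ).finrank_eq] at h2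
  simp only [Module.finrank_fintype_fun_eq_card, Fintype.card_sum] at h1 h2
  simp only [rank]
  omega

/-- Multiplication by the block diagonal matrices of `1, R` and `1, S` preserves the rank. Moving
the positions `J` to the end then leaves an identity block to eliminate. -/
theorem rank_fromBlocks_of_diagonal {l V : Type*} [Fintype l] [DecidableEq l] [Fintype V]
    [DecidableEq V] (A : Matrix l l F) (B : Matrix l V F) (C : Matrix V l F) (D R S : Matrix V V F)
    (J : Finset V) (hR : IsUnit R) (hS : IsUnit S)
    (h : R * D * S = diagonal fun u => if u ∈ J then 1 else 0) :
    (fromBlocks A B C D).rank =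
      (fromBlocks (A - (B * S).submatrix id (fun u : {u // u ∈ J} => u.1) *
          (R * C).submatrix (fun u : {u // u ∈ J} => u.1) id)
        ((B * S).submatrix id (fun u : {u // u ∉ J} => u.1))
        ((R * C).submatrix (fun u : {u // u ∉ J} => u.1) id) 0).rank + J.card := by
  have hblock : ∀ N : Matrix V V F, IsUnit N →
      IsUnit (fromBlocks (1 : Matrix l l F) 0 0 N).det := by
    intro N hN
    rw [det_fromBlocks_zero₂₁, det_one, one_mul]
    exact (isUnit_iff_isUnit_det N).1 hN
  rw [← rank_mul_eq_right_of_isUnit_det _ _ (hblock R hR),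
    ← rank_mul_eq_left_of_isUnit_det _ _ (hblock S hS)]
  simp only [fromBlocks_multiply, Matrix.one_mul, Matrix.zero_mul, Matrix.mul_zero, add_zero,
    zero_add, Matrix.mul_one, h]
  let e : (l ⊕ {u // u ∉ J}) ⊕ {u // u ∈ J} ≃ l ⊕ V :=
    (Equiv.sumAssoc _ _ _).trans ((Equiv.refl l).sumCongr
      ((Equiv.sumComm _ _).trans (Equiv.sumCompl (· ∈ J))))
  rw [← rank_submatrix _ e e]
  have he : (fromBlocks A (B * S) (R * C)
      (diagonal fun u => if u ∈ J then (1 : F) else 0)).submatrix e e =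
      fromBlocks (fromBlocks A ((B * S).submatrix id (fun u : {u // u ∉ J} => u.1))
          ((R * C).submatrix (fun u : {u // u ∉ J} => u.1) id) 0)
        (fromRows ((B * S).submatrix id (fun u : {u // u ∈ J} => u.1)) 0)
        (fromCols ((R * C).submatrix (fun u : {u // u ∈ J} => u.1) id) 0) 1 := by
    ext ((i | i) | i) ((j | j) | j)
    · simp [e]
    · simp [e]
    · simp [e]
    · simp [e]
    · by_cases hij : i.1 = j.1 <;> simp [e, diagonal_apply, i.2]
    · have : i.1 ≠ j.1 := fun h => i.2 (h ▸ j.2)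
      simp [e, this]
    · simp [e]
    · have : i.1 ≠ j.1 := fun h => j.2 (h ▸ i.2)
      simp [e, this]
    · rcases eq_or_ne i j with rfl | hij
      · simp [e]
      · have : i.1 ≠ j.1 := fun h => hij (Subtype.ext h)
        simp [e, this, hij]
  rw [he, rank_fromBlocks_one_right, Fintype.card_coe, fromRows_mul_fromCols]
  congr 2
  ext (i | i) (j | j) <;> simp

theorem rank_eq_card_of_diagonal {V : Type*} [Fintype V]
    [DecidableEq V] (D R S : Matrix V V F) (J : Finset V) (hR : IsUnit R) (hS : IsUnit S)
    (h : R * D * S = diagonal fun u => if u ∈ J then 1 else 0) : D.rank = J.card := by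
  classical
  rw [← rank_mul_eq_right_of_isUnit_det R D ((isUnit_iff_isUnit_det R).1 hR),
    ← rank_mul_eq_left_of_isUnit_det S (R * D) ((isUnit_iff_isUnit_det S).1 hS), h, rank_diagonal]
  simp

theorem exists_diagonal_eq {V : Type*} [Fintype V] [DecidableEq V] (D : Matrix V V F) :
    ∃ (R S : Matrix V V F) (J : Finset V), IsUnit R ∧ IsUnit S ∧
      R * D * S = diagonal fun u => if u ∈ J then 1 else 0 := by
  obtain ⟨R, S, e, hR, hS, h⟩ := D.exists_rank_normal_form
  refine ⟨R, S, Finset.univ.filter fun u => (e u).isLeft, hR, hS, ?_⟩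
  rw [h, ← diagonal_one, ← diagonal_zero, fromBlocks_diagonal, submatrix_diagonal_equiv]
  congr 1
  funext u
  rcases hu : e u with i | i <;> simp [hu]

/-- If `B' = B * Z`, the left matrix is the right one times the block diagonal matrix of `1` and
`Z`. Thus only the column span of the border matters. -/
theorem rank_fromBlocks_le_of_span_le {l m W W' : Type*} [Fintype l] [DecidableEq l] [Fintype W]
    [Fintype W'] (A : Matrix l l F) (B : Matrix l W F) (B' : Matrix l W' F) (C : Matrix m l F)
    (h : Submodule.span F (Set.range B'.col) ≤ Submodule.span F (Set.range B.col)) :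
    (fromBlocks A B' C 0).rank ≤ (fromBlocks A B C 0).rank := by
  obtain ⟨Z, rfl⟩ := (span_range_col_le_iff B' B).1 h
  have : fromBlocks A (B * Z) C 0 =
      fromBlocks A B C 0 * (fromBlocks 1 0 0 Z : Matrix (l ⊕ W) (l ⊕ W') F) := by
    rw [fromBlocks_multiply]
    simp
  rw [this]
  exact rank_mul_le_left _ _

theorem rank_fromBlocks_congr_cols {l m W W' : Type*} [Fintype l]
    [DecidableEq l] [Fintype W] [Fintype W']
    (A : Matrix l l F) (B : Matrix l W F) (B' : Matrix l W' F) (C : Matrix m l F)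
    (h : Submodule.span F (Set.range B'.col) = Submodule.span F (Set.range B.col)) :
    (fromBlocks A B C 0).rank = (fromBlocks A B' C 0).rank :=
  le_antisymm (rank_fromBlocks_le_of_span_le A B' B C h.ge)
    (rank_fromBlocks_le_of_span_le A B B' C h.le)

end Matrix

/-! ### Correctness of the sketch. -/

/-- The query enters only the terminal block, which the elimination changes by a term independent of
`Q`. The identity is deterministic. -/
theorem IsTutteSketch.rank_add {p n k : ℕ} [Fact p.Prime] {G : SimpleGraph (Fin n)}
    {q : Fin k ↪ Fin n} {x : Fin n → Fin n → ZMod p} {a : Fin k → Fin k → ZMod p}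
    {s : TutteSketch p k} (h : IsTutteSketch G q x a s) (Q : SimpleGraph (Fin k)) :
    (s.Mhat Q).rank + s.r = (queriedTutteMatrix G q Q x a).rank := by
  classical
  obtain ⟨hr, hA, R, S, J, hR, hS, hD, hA1, ⟨_, _, _, _, hB⟩, ⟨_, _, _, _, hC⟩⟩ := h
  rw [hr, Matrix.rank_eq_card_of_diagonal _ R S J hR hS hD]
  let e : Fin k ⊕ {v : Fin n // ∀ i, q i ≠ v} ≃ Fin n :=
    ((Equiv.ofInjective q q.injective).sumCongr (Equiv.subtypeEquivRight fun v => by simp)).trans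
      (Equiv.sumCompl (· ∈ Set.range q))
  have he1 : ∀ i, e (.inl i) = q i := fun i => by simp [e]
  have he2 : ∀ v, e (.inr v) = v.1 := fun v => by simp [e]
  rw [← Matrix.rank_submatrix _ e e]
  have hblocks : (queriedTutteMatrix G q Q x a).submatrix e e = Matrix.fromBlocks
      (tutteMatrix Q a + (tutteMatrix G x).submatrix q q)
      ((tutteMatrix G x).submatrix q Subtype.val) ((tutteMatrix G x).submatrix Subtype.val q)
      ((tutteMatrix G x).submatrix Subtype.val Subtype.val) := by
    ext (i | u) (j | v)
    · simp [he1, queriedTutteMatrix_terminal, add_comm]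
    · simp [he1, he2, queriedTutteMatrix_of_right _ _ _ _ _ _ v.2]
    · simp [he1, he2, queriedTutteMatrix_of_left _ _ _ _ _ u.2]
    · simp [he2, queriedTutteMatrix_of_left _ _ _ _ _ u.2]
  rw [hblocks, Matrix.rank_fromBlocks_of_diagonal _ _ _ _ R S J hR hS hD, TutteSketch.Mhat, hA1,
    hA, add_sub_assoc]
  congr 1
  refine (Matrix.rank_fromBlocks_congr_cols _ _ _ _ hB).symm.trans ?_
  -- Transposition turns the picked rows of the lower border into picked columns.
  refine (Matrix.rank_transpose _).symm.trans (.trans ?_ (Matrix.rank_transpose _))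
  rw [Matrix.fromBlocks_transpose, Matrix.fromBlocks_transpose, Matrix.transpose_zero,
    Matrix.transpose_zero]
  exact (Matrix.rank_fromBlocks_congr_cols _ _ _ _ hC).symm

theorem IsTutteSketch.r_le {p n k : ℕ} [Fact p.Prime] {G : SimpleGraph (Fin n)}
    {q : Fin k ↪ Fin n} {x : Fin n → Fin n → ZMod p} {a : Fin k → Fin k → ZMod p}
    {s : TutteSketch p k} (h : IsTutteSketch G q x a s) : s.r ≤ n := by
  rw [h.1]
  refine (Matrix.rank_le_card_width _).trans ((Fintype.card_subtype_le _).trans_eq (by simp))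

theorem PMF.map_uniformOfFintype_apply {α β : Type*} [Fintype α] [Nonempty α] [DecidableEq β]
    (f : α → β) (b : β) : (PMF.uniformOfFintype α).map f b =
      (Finset.univ.filter fun a => f a = b).card / (Fintype.card α : ENNReal) := by
  rw [PMF.map_apply, tsum_fintype]
  simp only [PMF.uniformOfFintype_apply]
  rw [← Finset.sum_filter, Finset.sum_const, nsmul_eq_mul, div_eq_mul_inv]
  congr 3
  ext a
  simp [eq_comm]

/-- By `IsTutteSketch.rank_add` the answer is half the rank of the queried Tutte matrix. It can be
wrong only where this rank is not `2ν`, a fraction of at most `n/p ≤ δ`. -/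
theorem SketchingScheme.StoresTutteSketch.answers {S : SketchingScheme} {k : ℕ} {p : ℕ → ℕ}
    [∀ n, Fact (p n).Prime] (h : S.StoresTutteSketch k p) {δ : ℝ} (hδ : 0 < δ)
    (hp : ∀ n : ℕ, (n : ℝ) / δ ≤ p n) : S.Answers k matchingNumber δ := by
  intro n G q Q
  obtain ⟨encode, -, hcomp, hext⟩ := h
  obtain ⟨sketch, hsk, hdist⟩ := hcomp n G q
  have hkn : k ≤ n := by simpa using Fintype.card_le_of_embedding q
  have hans : S.answerDist G q Q = (PMF.uniformOfFintype ((Fin n → Fin n → ZMod (p n)) ×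
      (Fin k → Fin k → ZMod (p n)))).map fun ω => (sketch ω.1 ω.2).answer Q := by
    rw [SketchingScheme.answerDist, hdist, PMF.bind_map, ← PMF.bind_pure_comp]
    congr 1
    funext ω
    exact hext n _ Q hkn (hsk ω.1 ω.2).r_le
  rw [hans, PMF.map_uniformOfFintype_apply]
  set Ω := (Fin n → Fin n → ZMod (p n)) × (Fin k → Fin k → ZMod (p n))
  set ν := matchingNumber (queried G q Q)
  have hbad := card_rank_ne_mul_le (F := ZMod (p n)) G q Q
  rw [ZMod.card] at hbad
  have hgood : (Finset.univ.filter fun ω : Ω => ¬(queriedTutteMatrix G q Q ω.1 ω.2).rank ≠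
      2 * ν).card ≤ (Finset.univ.filter fun ω : Ω => (sketch ω.1 ω.2).answer Q = ν).card := by
    refine Finset.card_le_card fun ω hω => ?_
    simp only [Finset.mem_filter, Finset.mem_univ, true_and, not_not] at hω ⊢
    rw [TutteSketch.answer, (hsk ω.1 ω.2).rank_add Q, hω]
    omega
  have hsum := Finset.card_filter_add_card_filter_not (s := (Finset.univ : Finset Ω))
    fun ω : Ω => (queriedTutteMatrix G q Q ω.1 ω.2).rank ≠ 2 * ν
  rw [Finset.card_univ] at hsum
  have hpn : (0 : ℝ) < p n := by exact_mod_cast (Fact.out : (p n).Prime).pos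
  have hΩ : (0 : ℝ) < Fintype.card Ω := by exact_mod_cast Fintype.card_pos
  rw [ENNReal.le_div_iff_mul_le (.inl (by exact_mod_cast Fintype.card_ne_zero))
    (.inl (ENNReal.natCast_ne_top _)), ← ENNReal.ofReal_natCast,
    ← ENNReal.ofReal_natCast, ← ENNReal.ofReal_mul' hΩ.le]
  refine ENNReal.ofReal_le_ofReal ?_
  set bad := (Finset.univ.filter fun ω : Ω =>
    (queriedTutteMatrix G q Q ω.1 ω.2).rank ≠ 2 * ν).card
  have h1 : (bad : ℝ) * p n ≤ n * Fintype.card Ω := by exact_mod_cast hbad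
  have h2 : (n : ℝ) ≤ δ * p n := by
    have := hp n
    rwa [div_le_iff₀ hδ, mul_comm] at this
  have h3 : (bad : ℝ) ≤ δ * Fintype.card Ω := by
    refine le_of_mul_le_mul_right (h1.trans ?_) hpn
    calc (n : ℝ) * Fintype.card Ω ≤ δ * p n * Fintype.card Ω := by gcongr
      _ = _ := by ring
  have h4 : (Fintype.card Ω : ℝ) ≤ bad +
      (Finset.univ.filter fun ω : Ω => (sketch ω.1 ω.2).answer Q = ν).card := by
    exact_mod_cast hsum.symm.le.trans (Nat.add_le_add_left hgood _)
  linarith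

/-! ### Primitive recursive predicates and unbounded search. -/

section Primrec

variable {σ : Type*} [Primcodable σ]

/-- A family of functions of two numbers, jointly primitive recursive with the parameter. -/
def PrimrecMat (F : σ → ℕ → ℕ → ℕ) : Prop :=
  Primrec fun z : σ × ℕ × ℕ => F z.1 z.2.1 z.2.2

theorem PrimrecMat.comp {τ : Type*} [Primcodable τ] {F : σ → ℕ → ℕ → ℕ} (hF : PrimrecMat F)
    {s : τ → σ} {i j : τ → ℕ} (hs : Primrec s) (hi : Primrec i) (hj : Primrec j) :
    Primrec fun x => F (s x) (i x) (j x) :=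
  Primrec.comp hF (hs.pair (hi.pair hj))

theorem Primrec.sum_range {n : σ → ℕ} {f : σ → ℕ → ℕ} (hn : Primrec n) (hf : Primrec₂ f) :
    Primrec fun s => ∑ i ∈ Finset.range (n s), f s i := by
  have h : Primrec₂ fun (s : σ) (z : ℕ × ℕ) => z.2 + f s z.1 :=
    Primrec.nat_add.comp (Primrec.snd.comp Primrec.snd)
      (hf.comp Primrec.fst (Primrec.fst.comp Primrec.snd))
  refine (Primrec.nat_rec' hn (Primrec.const 0) h).of_eq fun s => ?_
  induction n s with
  | zero => rfl
  | succ m ih => rw [Finset.sum_range_succ, ← ih]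

theorem PrimrecPred.forall_lt_of {n : σ → ℕ} {P : σ → ℕ → Prop} (hn : Primrec n)
    (hP : PrimrecRel P) : PrimrecPred fun s => ∀ i < n s, P s i :=
  ((PrimrecRel.forall_mem_list hP.swap).comp (Primrec.list_range.comp hn) Primrec.id).of_eq
    fun s => by simp [Function.swap]

theorem PrimrecPred.exists_lt_of {n : σ → ℕ} {P : σ → ℕ → Prop} (hn : Primrec n)
    (hP : PrimrecRel P) : PrimrecPred fun s => ∃ i < n s, P s i :=
  ((PrimrecRel.exists_mem_list hP.swap).comp (Primrec.list_range.comp hn) Primrec.id).of_eq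
    fun s => by simp [Function.swap]

theorem PrimrecPred.imp {P Q : σ → Prop} (hP : PrimrecPred P) (hQ : PrimrecPred Q) :
    PrimrecPred fun s => P s → Q s :=
  (hP.not.or hQ).of_eq fun _ => imp_iff_not_or.symm

theorem Primrec.nat_pow : Primrec₂ fun a b : ℕ => a ^ b :=
  Primrec₂.unpaired'.1 Nat.Primrec.pow

/-- Minimization is total when a witness always exists. The map `g` is only required to be
computable, since it will supply a prime that is itself found by search. -/
theorem exists_computable_search {α β : Type*} [Primcodable α] [Primcodable β] {P : β → ℕ → Prop}
    (hP : PrimrecRel P) {g : α → β} (hg : Computable g) (h : ∀ a, ∃ w, P (g a) w) :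
    ∃ f : α → ℕ, Computable f ∧ ∀ a, P (g a) (f a) := by
  classical
  refine ⟨fun a => Nat.find (h a), Computable.find (P := fun a w => P (g a) w) ?_ h,
    fun a => Nat.find_spec (h a)⟩
  exact Computable.computablePred
    (hP.decide.to_comp.comp (hg.comp Computable.fst) Computable.snd)

end Primrec

/-! ### Modular matrices given by functions on natural numbers -/

/-- The product of two matrices, the inner index running over the numbers below `n` weighted
by `ν`. -/
def natMul (n : ℕ) (ν : ℕ → ℕ) (F G : ℕ → ℕ → ℕ) (i j : ℕ) : ℕ :=
  ∑ l ∈ Finset.range n, ν l * (F i l * G l j)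

/-- Congruence modulo `p` of the entries in the rows and columns selected by `ν` and `μ`. -/
def ModEqOn (p n m : ℕ) (ν μ : ℕ → ℕ) (F G : ℕ → ℕ → ℕ) : Prop :=
  ∀ i < n, ∀ j < m, ν i ≠ 0 → μ j ≠ 0 → F i j % p = G i j % p

/-- The entry of a Tutte matrix modulo `p`. -/
def natTutte (p : ℕ) (e : ℕ → ℕ → Bool) (x : ℕ → ℕ → ℕ) (i j : ℕ) : ℕ :=
  if e i j = true then (if i < j then x i j else (p - 1) * x j i) else 0

section Primrec

variable {σ : Type*} [Primcodable σ]

theorem PrimrecMat.natMul {n : σ → ℕ} {ν : σ → ℕ → ℕ} {F G : σ → ℕ → ℕ → ℕ} (hn : Primrec n)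
    (hν : Primrec₂ ν) (hF : PrimrecMat F) (hG : PrimrecMat G) :
    PrimrecMat fun s => natMul (n s) (ν s) (F s) (G s) := by
  have h1 : Primrec fun z : (σ × ℕ × ℕ) × ℕ => z.1.1 := Primrec.fst.comp Primrec.fst
  have h2 : Primrec fun z : (σ × ℕ × ℕ) × ℕ => z.1.2.1 :=
    Primrec.fst.comp (Primrec.snd.comp Primrec.fst)
  have h3 : Primrec fun z : (σ × ℕ × ℕ) × ℕ => z.1.2.2 :=
    Primrec.snd.comp (Primrec.snd.comp Primrec.fst)
  exact Primrec.sum_range (hn.comp Primrec.fst)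
    (Primrec.nat_mul.comp (hν.comp h1 Primrec.snd)
      (Primrec.nat_mul.comp (hF.comp h1 h2 Primrec.snd) (hG.comp h1 Primrec.snd h3)))

theorem PrimrecMat.modEqOn {p n m : σ → ℕ} {ν μ : σ → ℕ → ℕ} {F G : σ → ℕ → ℕ → ℕ}
    (hp : Primrec p) (hn : Primrec n) (hm : Primrec m) (hν : Primrec₂ ν) (hμ : Primrec₂ μ)
    (hF : PrimrecMat F) (hG : PrimrecMat G) :
    PrimrecPred fun s => ModEqOn (p s) (n s) (m s) (ν s) (μ s) (F s) (G s) := by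
  have h1 : Primrec fun z : (σ × ℕ) × ℕ => z.1.1 := Primrec.fst.comp Primrec.fst
  have h2 : Primrec fun z : (σ × ℕ) × ℕ => z.1.2 := Primrec.snd.comp Primrec.fst
  have h3 : Primrec fun z : (σ × ℕ) × ℕ => z.2 := Primrec.snd
  refine PrimrecPred.forall_lt_of hn (PrimrecPred.forall_lt_of (hm.comp Primrec.fst) ?_)
  refine PrimrecPred.imp (Primrec.eq.comp (hν.comp h1 h2) (Primrec.const 0)).not
    (PrimrecPred.imp (Primrec.eq.comp (hμ.comp h1 h3) (Primrec.const 0)).not ?_)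
  exact Primrec.eq.comp (Primrec.nat_mod.comp (hF.comp h1 h2 h3) (hp.comp h1))
    (Primrec.nat_mod.comp (hG.comp h1 h2 h3) (hp.comp h1))

theorem PrimrecMat.natTutte {p : σ → ℕ} {e : σ → ℕ → ℕ → Bool} {x : σ → ℕ → ℕ → ℕ}
    (hp : Primrec p) (he : Primrec fun z : σ × ℕ × ℕ => e z.1 z.2.1 z.2.2) (hx : PrimrecMat x) :
    PrimrecMat fun s => natTutte (p s) (e s) (x s) := by
  have h2 : Primrec fun z : σ × ℕ × ℕ => z.2.1 := Primrec.fst.comp Primrec.snd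
  have h3 : Primrec fun z : σ × ℕ × ℕ => z.2.2 := Primrec.snd.comp Primrec.snd
  refine Primrec.ite (Primrec.eq.comp he (Primrec.const true)) (Primrec.ite
    (Primrec.nat_lt.comp h2 h3) hx ?_) (Primrec.const 0)
  exact Primrec.nat_mul.comp
    (Primrec.nat_sub.comp (hp.comp Primrec.fst) (Primrec.const 1)) (hx.comp Primrec.fst h3 h2)

end Primrec

/-- The map `ι` enumerates the numbers below `n` that are selected by `ν`. -/
structure IsIndexing {V : Type*} (n : ℕ) (ν : ℕ → ℕ) (ι : V → ℕ) : Prop where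
  injective : Function.Injective ι
  lt : ∀ v, ι v < n
  eq_one : ∀ v, ν (ι v) = 1
  exists_eq : ∀ u < n, ν u ≠ 0 → ∃ v, ι v = u

theorem isIndexing_fin (n : ℕ) : IsIndexing n (fun _ => 1) (Fin.val : Fin n → ℕ) where
  injective := Fin.val_injective
  lt v := v.2
  eq_one _ := rfl
  exists_eq u hu _ := ⟨⟨u, hu⟩, rfl⟩

/-- The matrix over `ℤ/p` with the entries `F (ι v) (κ w)`. -/
def castMat (p : ℕ) {V W : Type*} (ι : V → ℕ) (κ : W → ℕ) (F : ℕ → ℕ → ℕ) :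
    Matrix V W (ZMod p) :=
  Matrix.of fun v w => (F (ι v) (κ w) : ZMod p)

section CastMat

variable {p n m : ℕ} {U V W : Type*} {ν μ : ℕ → ℕ} {ι : V → ℕ} {κ : W → ℕ} {θ : U → ℕ}

/-- Below `n` the weight `ν` is the indicator of the image of `ι`. Sums over nonterminals, pivots or
nonpivots thus become weighted sums over a range, with no renumbering of vertices. -/
theorem IsIndexing.sum_eq [Fintype V] (h : IsIndexing n ν ι) {R : Type*} [CommSemiring R]
    (f : ℕ → R) : ∑ u ∈ Finset.range n, (ν u : R) * f u = ∑ v, f (ι v) := by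
  classical
  have h1 : ∑ v, f (ι v) = ∑ u ∈ Finset.univ.map ⟨ι, h.injective⟩, (ν u : R) * f u := by
    rw [Finset.sum_map]
    exact Finset.sum_congr rfl fun v _ => by simp [h.eq_one]
  rw [h1]
  symm
  refine Finset.sum_subset (fun u hu => ?_) fun u hu hu' => ?_
  · obtain ⟨v, -, rfl⟩ := Finset.mem_map.1 hu
    exact Finset.mem_range.2 (h.lt v)
  · have : ν u = 0 := by
      by_contra hne
      obtain ⟨v, rfl⟩ := h.exists_eq u (Finset.mem_range.1 hu) hne
      exact hu' (Finset.mem_map.2 ⟨v, Finset.mem_univ _, rfl⟩)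
    simp [this]

theorem castMat_natMul [Fintype V] (h : IsIndexing n ν ι) (F G : ℕ → ℕ → ℕ) :
    castMat p θ κ (natMul n ν F G) = castMat p θ ι F * castMat p ι κ G := by
  ext i j
  simp only [castMat, natMul, Matrix.of_apply, Matrix.mul_apply, Nat.cast_sum, Nat.cast_mul]
  exact h.sum_eq fun l => (F (θ i) l : ZMod p) * G l (κ j)

theorem modEqOn_iff (hι : IsIndexing n ν ι) (hκ : IsIndexing m μ κ) (F G : ℕ → ℕ → ℕ) :
    ModEqOn p n m ν μ F G ↔ castMat p ι κ F = castMat p ι κ G := by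
  constructor
  · intro h
    ext i j
    exact (ZMod.natCast_eq_natCast_iff' _ _ _).2
      (h _ (hι.lt i) _ (hκ.lt j) (by simp [hι.eq_one]) (by simp [hκ.eq_one]))
  · intro h i hi j hj hνi hμj
    obtain ⟨v, rfl⟩ := hι.exists_eq i hi hνi
    obtain ⟨w, rfl⟩ := hκ.exists_eq j hj hμj
    exact (ZMod.natCast_eq_natCast_iff' _ _ _).1 (congrFun (congrFun h v) w)

theorem castMat_congr (hι : ∀ v, ι v < n) (hκ : ∀ w, κ w < n) {F G : ℕ → ℕ → ℕ}
    (h : ∀ i < n, ∀ j < n, F i j = G i j) : castMat p ι κ F = castMat p ι κ G := by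
  ext v w
  simp [castMat, h _ (hι v) _ (hκ w)]

theorem exists_castMat_eq [NeZero p] (hι : Function.Injective ι) (hκ : Function.Injective κ)
    (N : Matrix V W (ZMod p)) : ∃ F, castMat p ι κ F = N := by
  refine ⟨fun i j => Function.extend (Prod.map ι κ) (fun z => (N z.1 z.2).val) 0 (i, j), ?_⟩
  ext v w
  have := (hι.prodMap hκ).extend_apply (fun z => (N z.1 z.2).val) 0 (v, w)
  simp only [Prod.map_apply] at this
  simp [castMat, this]

theorem castMat_diag [DecidableEq V] (hι : Function.Injective ι) (d : ℕ → ℕ) :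
    castMat p ι ι (fun i j => if i = j then d i else 0) =
      Matrix.diagonal fun v => (d (ι v) : ZMod p) := by
  ext v w
  simp only [castMat, Matrix.of_apply, Matrix.diagonal_apply, hι.eq_iff]
  split_ifs <;> simp

/-- The factor `p - 1` represents `-1` modulo `p`. -/
theorem castMat_natTutte [NeZero p] {k : ℕ} (G : SimpleGraph (Fin k)) (e : ℕ → ℕ → Bool)
    (x : ℕ → ℕ → ℕ) (y : Fin k → Fin k → ZMod p)
    (he : ∀ i j : Fin k, e i j = true ↔ G.Adj i j) (hx : ∀ i j : Fin k, (x i j : ZMod p) = y i j) :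
    castMat p Fin.val Fin.val (natTutte p e x) = tutteMatrix G y := by
  ext i j
  have hp : 1 ≤ p := NeZero.one_le
  by_cases hij : G.Adj i j
  · by_cases hlt : i < j
    · simp [castMat, natTutte, tutteMatrix, (he i j).2 hij, hij, hlt, hx]
    · simp [castMat, natTutte, tutteMatrix, (he i j).2 hij, hij, hlt, hx, Nat.cast_sub hp]
  · simp [castMat, natTutte, tutteMatrix, he, hij]

end CastMat

/-! ### Certificates -/

/-- The entry `(i, j)` of the matrix number `t` coded by `w`. -/
def codedEntry (w t i j : ℕ) : ℕ :=
  (Denumerable.ofNat (List ℕ) w).getD (Nat.pair t (Nat.pair i j)) 0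

/-- A list holds finitely many values, so agreement is possible only below a bound. The list is
taken long enough to contain the position of every triple below `m`. -/
theorem exists_codedEntry_eq (F : ℕ → ℕ → ℕ → ℕ) (m : ℕ) :
    ∃ w, ∀ t < m, ∀ i < m, ∀ j < m, codedEntry w t i j = F t i j := by
  let T := Finset.range m ×ˢ Finset.range m ×ˢ Finset.range m
  let g : ℕ × ℕ × ℕ → ℕ := fun z => Nat.pair z.1 (Nat.pair z.2.1 z.2.2)
  let l := (List.range (T.sup g + 1)).map fun z =>
    F z.unpair.1 z.unpair.2.unpair.1 z.unpair.2.unpair.2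
  refine ⟨Encodable.encode l, fun t ht i hi j hj => ?_⟩
  have hle : Nat.pair t (Nat.pair i j) ≤ T.sup g :=
    Finset.le_sup (f := g) (b := (t, i, j)) (by simp [T, ht, hi, hj])
  rw [codedEntry, Denumerable.ofNat_encode]
  simp [l, List.getD_eq_getElem?_getD, List.getElem?_range (Nat.lt_succ_of_le hle)]

theorem primrecMat_codedEntry (t : ℕ) {σ : Type*} [Primcodable σ] {w : σ → ℕ} (hw : Primrec w) :
    PrimrecMat fun s => codedEntry (w s) t :=
  (Primrec.list_getD 0).comp ((Primrec.ofNat (List ℕ)).comp (hw.comp Primrec.fst))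
    (Primrec₂.natPair.comp (Primrec.const t) (Primrec₂.natPair.comp
      (Primrec.fst.comp Primrec.snd) (Primrec.snd.comp Primrec.snd)))

/-- Whether `i` is a pivot, according to the certificate `g`. -/
def pivot (g : ℕ → ℕ → ℕ → ℕ) (i : ℕ) : ℕ := g 4 i 0 % 2

/-- The matrices `g 0` and `g 2`, with the inverses `g 1` and `g 3`, turn `D` into a diagonal matrix
with ones in the pivot positions. -/
def DiagCert (p n : ℕ) (ν : ℕ → ℕ) (D : ℕ → ℕ → ℕ) (g : ℕ → ℕ → ℕ → ℕ) : Prop :=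
  ModEqOn p n n ν ν (natMul n ν (g 0) (g 1)) (fun i j => if i = j then 1 else 0) ∧
  ModEqOn p n n ν ν (natMul n ν (g 2) (g 3)) (fun i j => if i = j then 1 else 0) ∧
  ModEqOn p n n ν ν (natMul n ν (natMul n ν (g 0) D) (g 2))
    (fun i j => if i = j then pivot g i else 0)

/-- The columns of `B` with the numbers `c 0, c 1, …`; zero if the number is not below `n`. -/
def pickedColumns (n : ℕ) (B : ℕ → ℕ → ℕ) (c : ℕ → ℕ) (i t : ℕ) : ℕ :=
  if c t < n then B i (c t) else 0

/-- The columns `c 0, …, c (k - 1)` of `B` are distinct and span the space of all columns selected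
by `μ`, the matrix of coefficients being `Z`. -/
def PickCert (p n k : ℕ) (μ : ℕ → ℕ) (B : ℕ → ℕ → ℕ) (c : ℕ → ℕ) (Z : ℕ → ℕ → ℕ) : Prop :=
  (∀ s < k, ∀ t < k, c s < n → c s = c t → s = t) ∧
  (∀ t < k, c t < n → μ (c t) ≠ 0) ∧
  ((∀ t < k, c t < n) ∨ ∀ u < n, μ u ≠ 0 → ∃ t < k, c t = u) ∧
  ModEqOn p k n (fun _ => 1) μ B (natMul k (fun _ => 1) (pickedColumns n B c) Z)

section Primrec

variable {σ : Type*} [Primcodable σ] {p n : σ → ℕ} {ν : σ → ℕ → ℕ} {D : σ → ℕ → ℕ → ℕ}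
  {g : σ → ℕ → ℕ → ℕ → ℕ}

theorem primrec_pivot (hg : ∀ t, PrimrecMat fun s => g s t) : Primrec₂ fun s => pivot (g s) :=
  Primrec.nat_mod.comp ((hg 4).comp Primrec.fst Primrec.snd (Primrec.const 0)) (Primrec.const 2)

theorem primrecMat_diag {d : σ → ℕ → ℕ} (hd : Primrec₂ d) :
    PrimrecMat fun s i j => if i = j then d s i else 0 :=
  Primrec.ite (Primrec.eq.comp (Primrec.fst.comp Primrec.snd) (Primrec.snd.comp Primrec.snd))
    (hd.comp Primrec.fst (Primrec.fst.comp Primrec.snd)) (Primrec.const 0)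

theorem primrecPred_diagCert (hp : Primrec p) (hn : Primrec n) (hν : Primrec₂ ν)
    (hD : PrimrecMat D) (hg : ∀ t, PrimrecMat fun s => g s t) :
    PrimrecPred fun s => DiagCert (p s) (n s) (ν s) (D s) (g s) := by
  refine (PrimrecMat.modEqOn hp hn hn hν hν (.natMul hn hν (hg 0) (hg 1))
    (primrecMat_diag (d := fun _ _ => 1) (Primrec.const 1))).and
    ((PrimrecMat.modEqOn hp hn hn hν hν (.natMul hn hν (hg 2) (hg 3))
      (primrecMat_diag (d := fun _ _ => 1) (Primrec.const 1))).and
    (PrimrecMat.modEqOn hp hn hn hν hν (.natMul hn hν (.natMul hn hν (hg 0) hD) (hg 2))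
      (primrecMat_diag (primrec_pivot hg))))

theorem primrecMat_pickedColumns {B : σ → ℕ → ℕ → ℕ} {c : σ → ℕ → ℕ} (hn : Primrec n)
    (hB : PrimrecMat B) (hc : Primrec₂ c) :
    PrimrecMat fun s => pickedColumns (n s) (B s) (c s) := by
  have h : Primrec fun z : σ × ℕ × ℕ => c z.1 z.2.2 :=
    hc.comp Primrec.fst (Primrec.snd.comp Primrec.snd)
  exact Primrec.ite (Primrec.nat_lt.comp h (hn.comp Primrec.fst))
    (hB.comp Primrec.fst (Primrec.fst.comp Primrec.snd) h) (Primrec.const 0)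

theorem primrecPred_pickCert (k : ℕ) {B Z : σ → ℕ → ℕ → ℕ} {c : σ → ℕ → ℕ} {μ : σ → ℕ → ℕ}
    (hp : Primrec p) (hn : Primrec n) (hμ : Primrec₂ μ)
    (hB : PrimrecMat B) (hc : Primrec₂ c) (hZ : PrimrecMat Z) :
    PrimrecPred fun s => PickCert (p s) (n s) k (μ s) (B s) (c s) (Z s) := by
  have h1 : Primrec fun z : (σ × ℕ) × ℕ => z.1.1 := Primrec.fst.comp Primrec.fst
  have hc2 : Primrec fun z : (σ × ℕ) × ℕ => c z.1.1 z.1.2 := hc.comp h1 (Primrec.snd.comp Primrec.fst)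
  have hc3 : Primrec fun z : (σ × ℕ) × ℕ => c z.1.1 z.2 := hc.comp h1 Primrec.snd
  have hlt : PrimrecRel fun (s : σ) (t : ℕ) => c s t < n s :=
    Primrec.nat_lt.comp hc (hn.comp Primrec.fst)
  refine .and (.forall_lt_of (Primrec.const k) (.forall_lt_of (Primrec.const k)
    (.imp (Primrec.nat_lt.comp hc2 (hn.comp h1)) (.imp (Primrec.eq.comp hc2 hc3)
      (Primrec.eq.comp (Primrec.snd.comp Primrec.fst) Primrec.snd))))) (.and ?_ (.and (.or ?_ ?_) ?_))
  · exact .forall_lt_of (Primrec.const k)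
      (hlt.imp (Primrec.eq.comp (hμ.comp Primrec.fst hc) (Primrec.const 0)).not)
  · exact .forall_lt_of (Primrec.const k) hlt
  · refine .forall_lt_of hn (.imp (Primrec.eq.comp hμ (Primrec.const 0)).not
      (.exists_lt_of (Primrec.const k) ?_))
    exact Primrec.eq.comp hc3 (Primrec.snd.comp Primrec.fst)
  · exact PrimrecMat.modEqOn hp (Primrec.const k) hn (Primrec.const 1) hμ hB
      (.natMul (Primrec.const k) (Primrec.const 1) (primrecMat_pickedColumns hn hB hc) hZ)

end Primrec

section Certificates

variable {p n k : ℕ} {V W : Type*} [Fintype V] {ν μ : ℕ → ℕ} {ι : V → ℕ} {κ : W → ℕ}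

theorem diagCert_iff [DecidableEq V] (hι : IsIndexing n ν ι) (D : ℕ → ℕ → ℕ)
    (g : ℕ → ℕ → ℕ → ℕ) : DiagCert p n ν D g ↔
      castMat p ι ι (g 0) * castMat p ι ι (g 1) = 1 ∧
      castMat p ι ι (g 2) * castMat p ι ι (g 3) = 1 ∧
      castMat p ι ι (g 0) * castMat p ι ι D * castMat p ι ι (g 2) =
        Matrix.diagonal fun v => (pivot g (ι v) : ZMod p) := by
  have h1 := castMat_diag (p := p) hι.injective fun _ => 1
  simp only [Nat.cast_one, Matrix.diagonal_one] at h1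
  rw [DiagCert, modEqOn_iff hι hι, modEqOn_iff hι hι, modEqOn_iff hι hι, castMat_natMul hι,
    castMat_natMul hι, castMat_natMul hι, castMat_natMul hι, castMat_diag hι.injective (pivot g), h1]

theorem DiagCert.isUnit [DecidableEq V] (hι : IsIndexing n ν ι) {D : ℕ → ℕ → ℕ}
    {g : ℕ → ℕ → ℕ → ℕ} (h : DiagCert p n ν D g) :
    IsUnit (castMat p ι ι (g 0)) ∧ IsUnit (castMat p ι ι (g 2)) := by
  obtain ⟨h1, h2, -⟩ := (diagCert_iff hι D g).1 h
  exact ⟨IsUnit.of_mul_eq_one _ h1, IsUnit.of_mul_eq_one _ h2⟩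

/-- The pivot positions of a certificate. -/
def pivots (ι : V → ℕ) (g : ℕ → ℕ → ℕ → ℕ) : Finset V :=
  Finset.univ.filter fun v => pivot g (ι v) = 1

/-- The remainder modulo 2 is 0 or 1 whatever number is coded, so a certificate needs no separate
check of its pivot flags. -/
theorem pivot_eq (ι : V → ℕ) (g : ℕ → ℕ → ℕ → ℕ) (v : V) [Decidable (v ∈ pivots ι g)] :
    pivot g (ι v) = if v ∈ pivots ι g then 1 else 0 := by
  have h : pivot g (ι v) < 2 := Nat.mod_lt _ two_pos
  split_ifs with hv
  · simpa [pivots] using hv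
  · simp only [pivots, Finset.mem_filter, Finset.mem_univ, true_and] at hv
    omega

theorem DiagCert.mul_eq_diagonal [DecidableEq V] (hι : IsIndexing n ν ι) {D : ℕ → ℕ → ℕ}
    {g : ℕ → ℕ → ℕ → ℕ} (h : DiagCert p n ν D g) :
    castMat p ι ι (g 0) * castMat p ι ι D * castMat p ι ι (g 2) =
      Matrix.diagonal fun v => if v ∈ pivots ι g then 1 else 0 := by
  rw [((diagCert_iff hι D g).1 h).2.2]
  congr 1
  funext v
  rw [pivot_eq ι g v]
  split_ifs <;> simp

theorem DiagCert.rank_eq [DecidableEq V] [Fact p.Prime] (hι : IsIndexing n ν ι) {D : ℕ → ℕ → ℕ}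
    {g : ℕ → ℕ → ℕ → ℕ} (h : DiagCert p n ν D g) :
    (castMat p ι ι D).rank = ∑ u ∈ Finset.range n, ν u * pivot g u := by
  rw [Matrix.rank_eq_card_of_diagonal _ _ _ _ (h.isUnit hι).1 (h.isUnit hι).2
    (h.mul_eq_diagonal hι)]
  have := hι.sum_eq (R := ℕ) fun u => pivot g u
  simp only [Nat.cast_id] at this
  rw [this]
  simp [pivot_eq ι g]

theorem IsIndexing.pivots (hι : IsIndexing n ν ι) (g : ℕ → ℕ → ℕ → ℕ) :
    IsIndexing n (fun u => ν u * pivot g u) (fun v : {v // v ∈ pivots ι g} => ι v) where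
  injective := hι.injective.comp Subtype.val_injective
  lt v := hι.lt v
  eq_one v := by
    classical
    simp [hι.eq_one, pivot_eq ι g]
  exists_eq u hu h := by
    classical
    obtain ⟨v, rfl⟩ := hι.exists_eq u hu (left_ne_zero_of_mul h)
    have := right_ne_zero_of_mul h
    rw [pivot_eq ι g] at this
    exact ⟨⟨v, by simpa using this⟩, rfl⟩

theorem IsIndexing.nonpivots (hι : IsIndexing n ν ι) (g : ℕ → ℕ → ℕ → ℕ) :
    IsIndexing n (fun u => ν u * (1 - pivot g u))
      (fun v : {v // v ∉ _root_.pivots ι g} => ι v) where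
  injective := hι.injective.comp Subtype.val_injective
  lt v := hι.lt v
  eq_one v := by
    classical
    simp [hι.eq_one, pivot_eq ι g, v.2]
  exists_eq u hu h := by
    classical
    obtain ⟨v, rfl⟩ := hι.exists_eq u hu (left_ne_zero_of_mul h)
    have := right_ne_zero_of_mul h
    rw [pivot_eq ι g] at this
    refine ⟨⟨v, fun hv => ?_⟩, rfl⟩
    simp [hv] at this

/-- Picked columns are columns of `B` or zero, which gives one inclusion of the spans; the
coefficients `Z` give the other. -/
theorem PickCert.picksColumns [Fact p.Prime] (hκ : IsIndexing n μ κ) {B Z : ℕ → ℕ → ℕ} {c : ℕ → ℕ}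
    (h : PickCert p n k μ B c Z) : PicksColumns (castMat p (Fin.val : Fin k → ℕ) κ B)
      (castMat p Fin.val Fin.val (pickedColumns n B c)) := by
  classical
  obtain ⟨h1, h2, h3, h4⟩ := h
  have hex : ∀ t : Fin k, c t < n → ∃ w, κ w = c t := fun t ht =>
    hκ.exists_eq _ ht (h2 t t.2 ht)
  -- A number that is not below `n` codes an unfilled position.
  let d : Fin k → Option W := fun t => if ht : c t < n then some (hex t ht).choose else none
  have hd : ∀ t w, d t = some w ↔ κ w = c t := by
    intro t w
    by_cases ht : c t < n
    · simp only [d, ht, dif_pos, Option.some.injEq]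
      have := (hex t ht).choose_spec
      exact ⟨fun h => h ▸ this, fun h => hκ.injective (this.trans h.symm)⟩
    · simp only [d, ht, dif_neg, not_false_eq_true, reduceCtorEq, false_iff]
      intro hw
      exact ht (hw ▸ hκ.lt w)
  have hcol : ∀ i t, castMat p Fin.val Fin.val (pickedColumns n B c) i t =
      (d t).elim 0 fun w => castMat p (Fin.val : Fin k → ℕ) κ B i w := by
    intro i t
    cases hdt : d t with
    | none =>
      have : ¬c t < n := fun ht => by simp [d, ht] at hdt
      simp [castMat, pickedColumns, this]
    | some w =>
      have hw := (hd t w).1 hdt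
      have : c t < n := hw ▸ hκ.lt w
      simp [castMat, pickedColumns, this, hw]
  refine ⟨d, ?_, ?_, hcol, le_antisymm ?_ ?_⟩
  · intro s t w hs ht
    rw [hd] at hs ht
    exact Fin.ext (h1 s s.2 t t.2 (hs ▸ hκ.lt w) (hs ▸ ht))
  · refine h3.imp (fun h t => ?_) fun h w => ?_
    · simp [d, h t t.2]
    · obtain ⟨t, ht, htw⟩ := h _ (hκ.lt w) (by simp [hκ.eq_one])
      exact ⟨⟨t, ht⟩, (hd _ _).2 htw.symm⟩
  · rw [Submodule.span_le]
    rintro _ ⟨t, rfl⟩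
    cases hdt : d t with
    | none =>
      have : (castMat p Fin.val Fin.val (pickedColumns n B c)).col t = (0 : Fin k → ZMod p) := by
        funext i
        rw [Matrix.col_apply, hcol, hdt]
        rfl
      rw [this]
      exact Submodule.zero_mem _
    | some w =>
      refine Submodule.subset_span ⟨w, ?_⟩
      funext i
      rw [Matrix.col_apply, Matrix.col_apply, hcol, hdt]
      rfl
  · rw [modEqOn_iff (isIndexing_fin k) hκ, castMat_natMul (isIndexing_fin k)] at h4
    exact (Matrix.span_range_col_le_iff _ _).2 ⟨_, h4⟩

end Certificates

/-- A basis among the columns has at most `k` members, since the columns have `k` coordinates. It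
extends to a set of exactly `min k |W|` columns, which either fills all `k` positions or contains
every column. -/
theorem exists_pickedColumns {k : ℕ} {W F : Type*} [Fintype W] [Field F]
    (B : Matrix (Fin k) W F) : ∃ (c : Fin k → Option W) (Z : Matrix (Fin k) W F),
      (∀ s t w, c s = some w → c t = some w → s = t) ∧
      ((∀ t, c t ≠ none) ∨ ∀ w, ∃ t, c t = some w) ∧
      B = Matrix.of (fun i t => (c t).elim 0 fun w => B i w) * Z := by
  classical
  obtain ⟨κ, a, ha, hspan, hli⟩ := exists_linearIndependent' F B.col
  have := Finite.of_injective a ha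
  have := Fintype.ofFinite κ
  have hk : Fintype.card κ ≤ k := by simpa using hli.fintype_card_le_finrank
  have hW : Fintype.card κ ≤ Fintype.card W := Fintype.card_le_of_injective a ha
  let m := min k (Fintype.card W)
  obtain ⟨T, hT, hTcard⟩ := Finset.exists_superset_card_eq (s := Finset.univ.map ⟨a, ha⟩) (n := m)
    (by simpa [m] using ⟨hk, hW⟩) (by simp [m])
  let e : T ≃ Fin m := T.equivFinOfCardEq hTcard
  let c : Fin k → Option W := fun t => if h : (t : ℕ) < m then some (e.symm ⟨t, h⟩).1 else none
  have hc : ∀ t w, c t = some w ↔ ∃ h : w ∈ T, (t : ℕ) = e ⟨w, h⟩ := by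
    intro t w
    by_cases ht : (t : ℕ) < m
    · simp only [c, ht, dif_pos, Option.some.injEq]
      constructor
      · rintro rfl
        exact ⟨Subtype.prop _, by simp⟩
      · rintro ⟨h, h'⟩
        have : (⟨t, ht⟩ : Fin m) = e ⟨w, h⟩ := Fin.ext h'
        rw [this, Equiv.symm_apply_apply]
    · simp only [c, ht, dif_neg, not_false_eq_true, reduceCtorEq, false_iff, not_exists]
      intro h h'
      exact ht (h' ▸ (e ⟨w, h⟩).2)
  have hmem : ∀ w ∈ T, ∃ t, c t = some w := fun w hw =>
    ⟨⟨e ⟨w, hw⟩, (e ⟨w, hw⟩).2.trans_le (min_le_left _ _)⟩, (hc _ _).2 ⟨hw, rfl⟩⟩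
  have hle : Submodule.span F (Set.range B.col) ≤ Submodule.span F (Set.range
      (Matrix.of (fun i t => (c t).elim 0 fun w => B i w) : Matrix (Fin k) (Fin k) F).col) := by
    rw [← hspan]
    refine Submodule.span_mono ?_
    rintro _ ⟨u, rfl⟩
    obtain ⟨t, ht⟩ := hmem (a u) (hT (by simp))
    refine ⟨t, ?_⟩
    funext i
    rw [Matrix.col_apply, Matrix.of_apply, ht]
    rfl
  obtain ⟨Z, hZ⟩ := (Matrix.span_range_col_le_iff _ _).1 hle
  refine ⟨c, Z, ?_, ?_, hZ⟩
  · intro s t w hs ht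
    obtain ⟨h, hs⟩ := (hc _ _).1 hs
    obtain ⟨_, ht⟩ := (hc _ _).1 ht
    exact Fin.ext (hs.trans ht.symm)
  · rcases le_total k (Fintype.card W) with h | h
    · refine .inl fun t => ?_
      have : (t : ℕ) < m := by simp [m, h]
      simp [c, this]
    · refine .inr fun w => hmem w ?_
      have : T = Finset.univ := by
        rw [← Finset.card_eq_iff_eq_univ, hTcard]
        exact min_eq_right h
      simp [this]

/-- The indicator function of the numbers different from `q 0, …, q (k - 1)`. -/
def nonterminal (k : ℕ) (q : ℕ → ℕ) (u : ℕ) : ℕ := if ∃ i < k, q i = u then 0 else 1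

/-- The rows of the terminals after the column operations. -/
def terminalRows (n k : ℕ) (M : ℕ → ℕ → ℕ) (q : ℕ → ℕ) (g : ℕ → ℕ → ℕ → ℕ) : ℕ → ℕ → ℕ :=
  natMul n (nonterminal k q) (fun i u => M (q i) u) (g 2)

/-- The columns of the terminals after the row operations, transposed. -/
def terminalCols (n k : ℕ) (M : ℕ → ℕ → ℕ) (q : ℕ → ℕ) (g : ℕ → ℕ → ℕ → ℕ) (j u : ℕ) : ℕ :=
  natMul n (nonterminal k q) (g 0) (fun u j => M u (q j)) u j

/-- A certificate that consists of row and column operations and of the choice of `k` columns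
and rows. -/
def CompressCert (p n k : ℕ) (M : ℕ → ℕ → ℕ) (q : ℕ → ℕ) (g : ℕ → ℕ → ℕ → ℕ) : Prop :=
  DiagCert p n (nonterminal k q) M g ∧
  PickCert p n k (fun u => nonterminal k q u * (1 - pivot g u)) (terminalRows n k M q g)
    (fun t => g 5 t 0) (g 7) ∧
  PickCert p n k (fun u => nonterminal k q u * (1 - pivot g u)) (terminalCols n k M q g)
    (fun t => g 6 t 0) (g 8)

/-- The block of the terminals after the elimination. -/
def eliminated (p n k : ℕ) (M : ℕ → ℕ → ℕ) (q : ℕ → ℕ) (g : ℕ → ℕ → ℕ → ℕ) (i j : ℕ) : ℕ :=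
  M (q i) (q j) + (p - 1) * natMul n (fun u => nonterminal k q u * pivot g u)
    (terminalRows n k M q g) (fun u j => terminalCols n k M q g j u) i j

section CompressCert

variable {p n k : ℕ}

/-- Converse of `PickCert.picksColumns`, given the coefficients; an unfilled position is coded by
`n`. -/
theorem pickCert_of [NeZero p] {W : Type*} [Fintype W] {μ : ℕ → ℕ} {κ : W → ℕ}
    (hκ : IsIndexing n μ κ) {B Z : ℕ → ℕ → ℕ} {c : ℕ → ℕ}
    {d : Fin k → Option W} (hd1 : ∀ s t w, d s = some w → d t = some w → s = t)
    (hd2 : (∀ t, d t ≠ none) ∨ ∀ w, ∃ t, d t = some w)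
    (hc : ∀ t : Fin k, c t = (d t).elim n κ)
    (hB : castMat p (Fin.val : Fin k → ℕ) κ B =
      Matrix.of (fun i t => (d t).elim 0 fun w => castMat p (Fin.val : Fin k → ℕ) κ B i w) *
        castMat p Fin.val κ Z) : PickCert p n k μ B c Z := by
  have hsome : ∀ t : Fin k, c t < n → ∃ w, d t = some w ∧ κ w = c t := by
    intro t ht
    have h := hc t
    cases hdt : d t with
    | none => rw [hdt] at h; exact absurd ht (by rw [h]; exact lt_irrefl _)
    | some w => rw [hdt] at h; exact ⟨w, rfl, h.symm⟩
  refine ⟨?_, ?_, ?_, ?_⟩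
  · intro s hs t ht hcs hst
    obtain ⟨w, hw, hw'⟩ := hsome ⟨s, hs⟩ hcs
    obtain ⟨w₂, hw₂, hw₂'⟩ := hsome ⟨t, ht⟩ (lt_of_eq_of_lt hst.symm hcs)
    have : w = w₂ := hκ.injective (hw'.trans (hst.trans hw₂'.symm))
    exact congrArg Fin.val (hd1 ⟨s, hs⟩ ⟨t, ht⟩ w hw (this ▸ hw₂))
  · intro t ht hct
    obtain ⟨w, -, hw⟩ := hsome ⟨t, ht⟩ hct
    have hw : κ w = c t := hw
    rw [← hw, hκ.eq_one]
    exact one_ne_zero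
  · refine hd2.imp (fun h t ht => ?_) fun h u hu hμ => ?_
    · obtain ⟨w, hw⟩ := Option.ne_none_iff_exists'.1 (h ⟨t, ht⟩)
      have := hc ⟨t, ht⟩
      rw [hw] at this
      exact lt_of_eq_of_lt this (hκ.lt w)
    · obtain ⟨w, rfl⟩ := hκ.exists_eq u hu hμ
      obtain ⟨t, ht⟩ := h w
      exact ⟨t, t.2, by rw [hc, ht]; rfl⟩
  · rw [modEqOn_iff (isIndexing_fin k) hκ, castMat_natMul (isIndexing_fin k), hB]
    congr 1
    ext i t
    cases hdt : d t with
    | none => simp [castMat, pickedColumns, hc, hdt]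
    | some w => simp [castMat, pickedColumns, hc, hdt, hκ.lt]

variable [Fact p.Prime]

/-- Slots 0 to 4 hold `R`, its inverse, `S`, its inverse and the pivot flags. The remaining slots
are prescribed by an `F` quantified after `R, S, J`, because the columns to pick depend on the
diagonalization. -/
theorem exists_codedEntry_castMat {V : Type*} [Fintype V] [DecidableEq V] {ν : ℕ → ℕ} {ι : V → ℕ}
    (hι : IsIndexing n ν ι) (D : ℕ → ℕ → ℕ) :
    ∃ (R S : Matrix V V (ZMod p)) (J : Finset V), ∀ F : ℕ → ℕ → ℕ → ℕ, ∀ m, n ≤ m → 9 ≤ m →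
      ∃ w, castMat p ι ι (codedEntry w 0) = R ∧ castMat p ι ι (codedEntry w 2) = S ∧
        pivots ι (codedEntry w) = J ∧ DiagCert p n ν D (codedEntry w) ∧
        ∀ t, 5 ≤ t → t < 9 → ∀ i < m, ∀ j < m, codedEntry w t i j = F t i j := by
  obtain ⟨R, S, J, hR, hS, hRS⟩ := (castMat p ι ι D).exists_diagonal_eq
  refine ⟨R, S, J, fun F m hnm hm => ?_⟩
  obtain ⟨f0, h0⟩ := exists_castMat_eq hι.injective hι.injective R
  obtain ⟨f1, h1⟩ := exists_castMat_eq hι.injective hι.injective R⁻¹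
  obtain ⟨f2, h2⟩ := exists_castMat_eq hι.injective hι.injective S
  obtain ⟨f3, h3⟩ := exists_castMat_eq hι.injective hι.injective S⁻¹
  let f4 : ℕ → ℕ → ℕ := fun i _ => Function.extend ι (fun v => if v ∈ J then 1 else 0) 0 i
  obtain ⟨w, hw⟩ := exists_codedEntry_eq (fun t => match t with
    | 0 => f0 | 1 => f1 | 2 => f2 | 3 => f3 | 4 => f4 | t => F t) m
  have hcast : ∀ t < m, ∀ f : ℕ → ℕ → ℕ, (∀ i < m, ∀ j < m, codedEntry w t i j = f i j) →
      castMat p ι ι (codedEntry w t) = castMat p ι ι f := fun t _ f hf =>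
    castMat_congr (fun v => (hι.lt v).trans_le hnm) (fun v => (hι.lt v).trans_le hnm) hf
  have h0' := (hcast 0 (by omega) f0 (hw 0 (by omega))).trans h0
  have h1' := (hcast 1 (by omega) f1 (hw 1 (by omega))).trans h1
  have h2' := (hcast 2 (by omega) f2 (hw 2 (by omega))).trans h2
  have h3' := (hcast 3 (by omega) f3 (hw 3 (by omega))).trans h3
  have h4' : ∀ v, pivot (codedEntry w) (ι v) = if v ∈ J then 1 else 0 := by
    intro v
    rw [pivot, hw 4 (by omega) _ ((hι.lt v).trans_le hnm) _ (by omega)]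
    simp only [f4, hι.injective.extend_apply]
    split_ifs <;> rfl
  refine ⟨w, h0', h2', ?_, (diagCert_iff hι D _).2 ⟨?_, ?_, ?_⟩, fun t ht ht' => ?_⟩
  · ext v
    simp [pivots, h4']
  · rw [h0', h1', Matrix.mul_nonsing_inv _ ((Matrix.isUnit_iff_isUnit_det _).1 hR)]
  · rw [h2', h3', Matrix.mul_nonsing_inv _ ((Matrix.isUnit_iff_isUnit_det _).1 hS)]
  · rw [h0', h2', hRS]
    congr 1
    funext v
    rw [h4']
    split_ifs <;> simp
  · rw [forall₂_congr fun i hi => forall₂_congr fun j hj => by rw [hw t (by omega) i hi j hj]]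
    -- Written as `t + 5`, the slot number makes the match reduce to its last branch.
    obtain ⟨t, rfl⟩ := Nat.exists_eq_add_of_le' ht
    intros
    rfl

theorem castMat_terminalRows {V : Type*} [Fintype V] {q : ℕ → ℕ} {ι : V → ℕ}
    (hι : IsIndexing n (nonterminal k q) ι) (M : ℕ → ℕ → ℕ) (g : ℕ → ℕ → ℕ → ℕ) {W : Type*}
    (f : W → V) : castMat p (Fin.val : Fin k → ℕ) (fun w => ι (f w)) (terminalRows n k M q g) =
      (castMat p (fun i : Fin k => q i) ι M * castMat p ι ι (g 2)).submatrix id f :=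
  castMat_natMul hι _ _

theorem castMat_terminalCols {V : Type*} [Fintype V] {q : ℕ → ℕ} {ι : V → ℕ}
    (hι : IsIndexing n (nonterminal k q) ι) (M : ℕ → ℕ → ℕ) (g : ℕ → ℕ → ℕ → ℕ) {W : Type*}
    (f : W → V) : castMat p (Fin.val : Fin k → ℕ) (fun w => ι (f w)) (terminalCols n k M q g) =
      ((castMat p ι ι (g 0) * castMat p ι (fun i : Fin k => q i) M).submatrix f id).transpose :=
  congrArg Matrix.transpose (castMat_natMul (p := p) (θ := fun w => ι (f w))
    (κ := (Fin.val : Fin k → ℕ)) hι (g 0) fun u j => M u (q j))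

theorem isIndexing_nonterminal (n k : ℕ) (q : ℕ → ℕ) :
    IsIndexing n (nonterminal k q) (fun v : {u : Fin n // nonterminal k q u ≠ 0} => (v.1 : ℕ)) where
  injective := Fin.val_injective.comp Subtype.val_injective
  lt v := v.1.2
  eq_one v := by
    have := v.2
    simp only [nonterminal] at this ⊢
    split_ifs at this ⊢ <;> simp_all
  exists_eq u hu h := ⟨⟨⟨u, hu⟩, h⟩, rfl⟩

/-- Slots 5 and 6 hold the picked columns and rows, slots 7 and 8 the coefficients that prove
spanning. Nothing is assumed of `M` and `q`, so the search halts on malformed inputs too. -/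
theorem exists_compressCert (n k : ℕ) (M : ℕ → ℕ → ℕ) (q : ℕ → ℕ) :
    ∃ w, CompressCert p n k M q (codedEntry w) := by
  let V := {u : Fin n // nonterminal k q u ≠ 0}
  let ι : V → ℕ := fun v => v.1
  have hι : IsIndexing n (nonterminal k q) ι := isIndexing_nonterminal n k q
  obtain ⟨R, S, J, h⟩ := exists_codedEntry_castMat (p := p) hι M
  obtain ⟨c, Z, hc1, hc2, hZ⟩ := exists_pickedColumns
    ((castMat p (fun i : Fin k => q i) ι M * S).submatrix id (fun u : {u // u ∉ J} => u.1))
  obtain ⟨c', Z', hc1', hc2', hZ'⟩ := exists_pickedColumns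
    ((R * castMat p ι (fun i : Fin k => q i) M).submatrix (fun u : {u // u ∉ J} => u.1) id).transpose
  have hinj : Function.Injective fun u : {u // u ∉ J} => ι u.1 :=
    hι.injective.comp Subtype.val_injective
  obtain ⟨f7, h7⟩ := exists_castMat_eq (ι := (Fin.val : Fin k → ℕ)) Fin.val_injective hinj Z
  obtain ⟨f8, h8⟩ := exists_castMat_eq (ι := (Fin.val : Fin k → ℕ)) Fin.val_injective hinj Z'
  let pos : (Fin k → Option {u // u ∉ J}) → ℕ → ℕ := fun c t =>
    if ht : t < k then (c ⟨t, ht⟩).elim n fun u => ι u.1 else 0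
  obtain ⟨w, hR, hS, hJ, hdiag, hw⟩ := h (fun t i j => match t with
    -- The bound exceeds all vertices, terminal indices and slot numbers.
    | 5 => pos c i | 6 => pos c' i | 7 => f7 i j | _ => f8 i j) (n + k + 9) (by omega) (by omega)
  subst hJ hR hS
  have hcast : ∀ t, 5 ≤ t → t < 9 → ∀ f : ℕ → ℕ → ℕ,
      (∀ i < n + k + 9, ∀ j < n + k + 9, codedEntry w t i j = f i j) →
      castMat p (Fin.val : Fin k → ℕ) (fun u : {u // u ∉ pivots ι (codedEntry w)} => ι u.1)
        (codedEntry w t) = castMat p Fin.val (fun u => ι u.1) f := fun t _ _ f hf =>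
    castMat_congr (n := n + k + 9) (ι := (Fin.val : Fin k → ℕ))
      (κ := fun u : {u // u ∉ pivots ι (codedEntry w)} => ι u.1) (fun v => by omega)
      (fun u => (hι.lt u.1).trans_le (by omega)) hf
  refine ⟨w, hdiag, ?_, ?_⟩
  · refine pickCert_of (hι.nonpivots (codedEntry w)) hc1 hc2 (fun t => ?_) ?_
    · rw [hw 5 (by omega) (by omega) _ (by omega) _ (by omega)]
      simp [pos]
    · rw [castMat_terminalRows hι, hcast 7 (by omega) (by omega) f7 (hw 7 (by omega) (by omega)), h7]
      exact hZ
  · refine pickCert_of (hι.nonpivots (codedEntry w)) hc1' hc2' (fun t => ?_) ?_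
    · rw [hw 6 (by omega) (by omega) _ (by omega) _ (by omega)]
      simp [pos]
    · rw [castMat_terminalCols hι, hcast 8 (by omega) (by omega) f8 (hw 8 (by omega) (by omega)), h8]
      exact hZ'

/-- The sketch that a certificate describes. -/
noncomputable def certSketch (p n k : ℕ) (M : ℕ → ℕ → ℕ) (q : ℕ → ℕ) (a : ℕ → ℕ → ℕ)
    (g : ℕ → ℕ → ℕ → ℕ) : TutteSketch p k where
  r := ∑ u ∈ Finset.range n, nonterminal k q u * pivot g u
  Ahat := castMat p Fin.val Fin.val a
  A1 := castMat p Fin.val Fin.val (eliminated p n k M q g)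
  B2 := castMat p Fin.val Fin.val (pickedColumns n (terminalRows n k M q g) fun t => g 5 t 0)
  C2 := (castMat p Fin.val Fin.val
    (pickedColumns n (terminalCols n k M q g) fun t => g 6 t 0)).transpose

/-- Every certificate yields a legitimate sketch, so it does not matter which one the search finds.
-/
theorem CompressCert.isTutteSketch {M : ℕ → ℕ → ℕ} {q' : ℕ → ℕ} {g : ℕ → ℕ → ℕ → ℕ}
    (h : CompressCert p n k M q' g) {G : SimpleGraph (Fin n)} {q : Fin k ↪ Fin n}
    (hq : ∀ i : Fin k, q' i = q i) {x : Fin n → Fin n → ZMod p} {a : Fin k → Fin k → ZMod p}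
    {b : ℕ → ℕ → ℕ} (hM : castMat p Fin.val Fin.val M = tutteMatrix G x)
    (hb : ∀ i j : Fin k, (b i j : ZMod p) = a i j) :
    IsTutteSketch G q x a (certSketch p n k M q' b g) := by
  let V := {v : Fin n // ∀ i, q i ≠ v}
  let ι : V → ℕ := fun v => v.1
  have hq' : ∀ u : Fin n, (∃ i < k, q' i = u) ↔ ∃ i, q i = u := by
    intro u
    constructor
    · rintro ⟨i, hi, h⟩
      exact ⟨⟨i, hi⟩, Fin.ext ((hq ⟨i, hi⟩).symm.trans h)⟩
    · rintro ⟨i, rfl⟩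
      exact ⟨i, i.2, hq i⟩
  have hι : IsIndexing n (nonterminal k q') ι :=
    { injective := Fin.val_injective.comp Subtype.val_injective
      lt := fun v => v.1.2
      eq_one := fun v => by
        have := v.2
        rw [nonterminal, if_neg]
        rw [hq']
        push Not
        exact this
      exists_eq := fun u hu h => by
        refine ⟨⟨⟨u, hu⟩, fun i hi => h ?_⟩, rfl⟩
        rw [nonterminal, if_pos]
        exact (hq' ⟨u, hu⟩).2 ⟨i, hi⟩ }
  have hM' : ∀ u v : Fin n, (M u v : ZMod p) = tutteMatrix G x u v := fun u v =>
    congrFun (congrFun hM u) v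
  have hD : castMat p ι ι M = (tutteMatrix G x).submatrix Subtype.val Subtype.val := by
    ext u v
    exact hM' u.1 v.1
  have hB : castMat p (fun i : Fin k => q' i) ι M =
      (tutteMatrix G x).submatrix q Subtype.val := by
    ext i v
    simp only [castMat, Matrix.of_apply, hq]
    exact hM' _ _
  have hC : castMat p ι (fun i : Fin k => q' i) M =
      (tutteMatrix G x).submatrix Subtype.val q := by
    ext v i
    simp only [castMat, Matrix.of_apply, hq]
    exact hM' _ _
  obtain ⟨h1, h2, h3⟩ := h
  have hdiag := h1.mul_eq_diagonal hι
  have hp2 := h2.picksColumns (hι.nonpivots g)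
  have hp3 := h3.picksColumns (hι.nonpivots g)
  rw [castMat_terminalRows hι, hB] at hp2
  rw [castMat_terminalCols hι, hC] at hp3
  refine ⟨?_, ?_, castMat p ι ι (g 0), castMat p ι ι (g 2), pivots ι g,
    (h1.isUnit hι).1, (h1.isUnit hι).2, ?_, ?_, hp2, ?_⟩
  · rw [← hD, h1.rank_eq hι]
    rfl
  · ext i j
    exact hb i j
  · rw [← hD, hdiag]
  -- The product `X * Y` is a sum over the pivots, that is, a `natMul` with the pivot weights.
  · have hXY := castMat_natMul (p := p) (hι.pivots g) (θ := (Fin.val : Fin k → ℕ))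
      (κ := (Fin.val : Fin k → ℕ)) (terminalRows n k M q' g)
      fun u j => terminalCols n k M q' g j u
    rw [castMat_terminalRows hι, hB] at hXY
    have hY := congrArg Matrix.transpose (castMat_terminalCols (p := p) hι M g
      fun v : {v // v ∈ pivots ι g} => v.1)
    rw [hC, Matrix.transpose_transpose] at hY
    change castMat p _ _ (fun u j => terminalCols n k M q' g j u) = _ at hY
    rw [hY] at hXY
    rw [← hXY]
    have hp : 1 ≤ p := (Fact.out : p.Prime).one_le
    ext i j
    simp only [certSketch, castMat, eliminated, Matrix.of_apply, Matrix.sub_apply,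
      Matrix.submatrix_apply, hq, Nat.cast_add, Nat.cast_mul, Nat.cast_sub hp, hM']
    simp [sub_eq_add_neg]
  · exact hp3

end CompressCert

/-! ### Encoding of sketches by machine words -/

/-- The list of `n`, `r` and the base `b` digits of the entries of four `k × k` matrices, `L` digits
for each entry. -/
def encodeWords (n r b L k : ℕ) (E : ℕ → ℕ → ℕ → ℕ) : List ℕ :=
  n :: r :: (List.range (4 * k * k * L)).map fun d =>
    E (d / L / k / k) (d / L / k % k) (d / L % k) / b ^ (d % L) % b

/-- The entry `(i, j)` of the matrix number `t` in an encoded list. -/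
def decodeWords (b L k : ℕ) (Γ : List ℕ) (t i j : ℕ) : ℕ :=
  ∑ d ∈ Finset.range L, Γ.getD (2 + (((t * k + i) * k + j) * L + d)) 0 * b ^ d

theorem Nat.sum_digits_mod (b x L : ℕ) :
    ∑ d ∈ Finset.range L, x / b ^ d % b * b ^ d = x % b ^ L := by
  induction L with
  | zero => simp [Nat.mod_one]
  | succ L ih => rw [Finset.sum_range_succ, ih, Nat.mod_pow_succ, mul_comm (b ^ L)]

/-- Digit `d` of the entry `(t, i, j)` has the mixed radix position `((t * k + i) * k + j) * L + d`,
shifted by 2 for the leading words `n` and `r`. Division and remainder recover the indices, and `L`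
digits lose nothing below `b ^ L`. -/
theorem decodeWords_encodeWords {n r b L k : ℕ} {E : ℕ → ℕ → ℕ → ℕ} {t i j : ℕ} (ht : t < 4)
    (hi : i < k) (hj : j < k) (h : E t i j < b ^ L) :
    decodeWords b L k (encodeWords n r b L k E) t i j = E t i j := by
  rw [decodeWords]
  refine .trans ?_ ((Nat.sum_digits_mod b (E t i j) L).trans (Nat.mod_eq_of_lt h))
  refine Finset.sum_congr rfl fun d hd => ?_
  rw [Finset.mem_range] at hd
  have h1 : t * k + i + 1 ≤ 4 * k := by
    calc t * k + i + 1 ≤ t * k + k := by omega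
      _ = (t + 1) * k := by ring
      _ ≤ 4 * k := by gcongr; omega
  have h2 : (t * k + i) * k + j + 1 ≤ 4 * k * k := by
    calc (t * k + i) * k + j + 1 ≤ (t * k + i) * k + k := by omega
      _ = (t * k + i + 1) * k := by ring
      _ ≤ 4 * k * k := by gcongr
  have h3 : ((t * k + i) * k + j) * L + d < 4 * k * k * L := by
    calc ((t * k + i) * k + j) * L + d < ((t * k + i) * k + j) * L + L := by omega
      _ = ((t * k + i) * k + j + 1) * L := by ring
      _ ≤ _ := by gcongr
  have hL : 0 < L := by omega
  have hk : 0 < k := by omega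
  have e1 : (((t * k + i) * k + j) * L + d) / L = (t * k + i) * k + j := by
    rw [mul_comm, Nat.mul_add_div hL, Nat.div_eq_of_lt hd, add_zero]
  have e2 : (((t * k + i) * k + j) * L + d) % L = d := by
    rw [mul_comm, Nat.mul_add_mod, Nat.mod_eq_of_lt hd]
  have e3 : ((t * k + i) * k + j) / k = t * k + i := by
    rw [mul_comm, Nat.mul_add_div hk, Nat.div_eq_of_lt hj, add_zero]
  have e4 : ((t * k + i) * k + j) % k = j := by
    rw [mul_comm, Nat.mul_add_mod, Nat.mod_eq_of_lt hj]
  have e5 : (t * k + i) / k = t := by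
    rw [mul_comm, Nat.mul_add_div hk, Nat.div_eq_of_lt hi, add_zero]
  have e6 : (t * k + i) % k = i := by
    rw [mul_comm, Nat.mul_add_mod, Nat.mod_eq_of_lt hi]
  congr 1
  rw [encodeWords, add_comm 2, List.getD_cons_succ, List.getD_cons_succ]
  simp [List.getD_eq_getElem?_getD, List.getElem?_range h3, e1, e2, e3, e4, e5, e6]

theorem encodeWords_congr {n r b L k : ℕ} {E E' : ℕ → ℕ → ℕ → ℕ}
    (h : ∀ t < 4, ∀ i < k, ∀ j < k, E t i j = E' t i j) :
    encodeWords n r b L k E = encodeWords n r b L k E' := by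
  simp only [encodeWords, List.cons.injEq, true_and]
  refine List.map_congr_left fun d hd => ?_
  rw [List.mem_range] at hd
  have hk : 0 < k := by
    rcases Nat.eq_zero_or_pos k with rfl | h
    · simp at hd
    · exact h
  have h1 : d / L < 4 * k * k := Nat.div_lt_of_lt_mul (by rwa [mul_comm])
  have h2 : d / L / k < 4 * k := Nat.div_lt_of_lt_mul (by rwa [mul_comm])
  rw [h _ (Nat.div_lt_of_lt_mul (by rwa [mul_comm])) _ (Nat.mod_lt _ hk) _ (Nat.mod_lt _ hk)]

theorem length_encodeWords (n r b L k : ℕ) (E : ℕ → ℕ → ℕ → ℕ) :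
    (encodeWords n r b L k E).length = 4 * k * k * L + 2 := by
  simp [encodeWords]

theorem mem_encodeWords_lt {n r b L k : ℕ} {E : ℕ → ℕ → ℕ → ℕ} (hn : n < b) (hr : r < b) {w : ℕ}
    (hw : w ∈ encodeWords n r b L k E) : w < b := by
  simp only [encodeWords, List.mem_cons, List.mem_map] at hw
  rcases hw with rfl | rfl | ⟨d, -, rfl⟩
  · exact hn
  · exact hr
  · exact Nat.mod_lt _ (by omega)

namespace TutteSketch

variable {p k : ℕ}

/-- The four matrices of a sketch. -/
def mat (s : TutteSketch p k) : ℕ → Matrix (Fin k) (Fin k) (ZMod p)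
  | 0 => s.Ahat
  | 1 => s.A1
  | 2 => s.B2
  | _ => s.C2

/-- The representatives in `{0, …, p - 1}` of the entries of the matrices of a sketch. -/
noncomputable def entry (s : TutteSketch p k) (t i j : ℕ) : ℕ :=
  if h : i < k ∧ j < k then (s.mat t ⟨i, h.1⟩ ⟨j, h.2⟩).val else 0

theorem entry_fin (s : TutteSketch p k) (t : ℕ) (i j : Fin k) :
    s.entry t i j = (s.mat t i j).val := by
  simp [entry]

theorem entry_lt [NeZero p] (s : TutteSketch p k) (t i j : ℕ) : s.entry t i j < p := by
  rw [entry]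
  split_ifs
  · exact ZMod.val_lt _
  · exact NeZero.pos p

theorem ext_mat {s s' : TutteSketch p k} (hr : s.r = s'.r) (h : ∀ t < 4, s.mat t = s'.mat t) :
    s = s' := by
  obtain ⟨r, A, A1, B, C⟩ := s
  obtain ⟨r', A', A1', B', C'⟩ := s'
  have h0 := h 0 (by omega)
  have h1 := h 1 (by omega)
  have h2 := h 2 (by omega)
  have h3 := h 3 (by omega)
  simp only [mat] at h0 h1 h2 h3 hr
  subst h0 h1 h2 h3 hr
  rfl

end TutteSketch

/-- The base of the digits in the sketches of `n`-vertex graphs. -/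
def wordBase (n : ℕ) : ℕ := max 2 (n + 1)

/-- The encoding of a sketch. -/
noncomputable def encodeSketch {p k : ℕ} (L n : ℕ) (s : TutteSketch p k) : List ℕ :=
  encodeWords n s.r (wordBase n) L k s.entry

theorem decodeWords_encodeSketch {p k L n : ℕ} [NeZero p] (hL : p ≤ wordBase n ^ L)
    (s : TutteSketch p k) {t : ℕ} (ht : t < 4) (i j : Fin k) :
    decodeWords (wordBase n) L k (encodeSketch L n s) t i j = (s.mat t i j).val := by
  rw [encodeSketch, decodeWords_encodeWords ht i.2 j.2 ((s.entry_lt t i j).trans_le hL),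
    s.entry_fin]

theorem encodeSketch_injective {p k L n : ℕ} [NeZero p] (hL : p ≤ wordBase n ^ L) :
    Function.Injective (encodeSketch L n : TutteSketch p k → List ℕ) := by
  intro s s' h
  refine TutteSketch.ext_mat ?_ fun t ht => ?_
  · simp only [encodeSketch, encodeWords, List.cons.injEq] at h
    exact h.2.1
  · ext i j
    refine ZMod.val_injective p ?_
    rw [← decodeWords_encodeSketch hL s ht, h, decodeWords_encodeSketch hL s' ht]

section Primrec

variable {σ : Type*} [Primcodable σ]

theorem primrec_wordBase : Primrec wordBase :=
  Primrec.nat_max.comp (Primrec.const 2) Primrec.succ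

theorem primrec_encodeWords {n r b : σ → ℕ} (L k : ℕ) {E : σ → ℕ → ℕ → ℕ → ℕ} (hn : Primrec n)
    (hr : Primrec r) (hb : Primrec b)
    (hE : Primrec fun z : σ × ℕ × ℕ × ℕ => E z.1 z.2.1 z.2.2.1 z.2.2.2) :
    Primrec fun s => encodeWords (n s) (r s) (b s) L k (E s) := by
  refine Primrec.list_cons.comp hn (Primrec.list_cons.comp hr
    (Primrec.list_map (Primrec.const _) ?_))
  have hd : Primrec fun z : σ × ℕ => z.2 / L :=
    Primrec.nat_div.comp Primrec.snd (Primrec.const L)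
  have hdk : Primrec fun z : σ × ℕ => z.2 / L / k := Primrec.nat_div.comp hd (Primrec.const k)
  refine Primrec.nat_mod.comp (Primrec.nat_div.comp (hE.comp (Primrec.fst.pair
    ((Primrec.nat_div.comp hdk (Primrec.const k)).pair
      ((Primrec.nat_mod.comp hdk (Primrec.const k)).pair
        (Primrec.nat_mod.comp hd (Primrec.const k))))))
    (Primrec.nat_pow.comp (hb.comp Primrec.fst)
      (Primrec.nat_mod.comp Primrec.snd (Primrec.const L)))) (hb.comp Primrec.fst)

theorem primrecMat_decodeWords {b : σ → ℕ} (L k : ℕ) {Γ : σ → List ℕ} (hb : Primrec b)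
    (hΓ : Primrec Γ) (t : ℕ) : PrimrecMat fun s => decodeWords (b s) L k (Γ s) t := by
  have hi : Primrec fun z : (σ × ℕ × ℕ) × ℕ => z.1.2.1 :=
    Primrec.fst.comp (Primrec.snd.comp Primrec.fst)
  have hj : Primrec fun z : (σ × ℕ × ℕ) × ℕ => z.1.2.2 :=
    Primrec.snd.comp (Primrec.snd.comp Primrec.fst)
  have hs : Primrec fun z : (σ × ℕ × ℕ) × ℕ => z.1.1 := Primrec.fst.comp Primrec.fst
  refine Primrec.sum_range (Primrec.const L) (Primrec.nat_mul.comp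
    ((Primrec.list_getD 0).comp (hΓ.comp hs) (Primrec.nat_add.comp (Primrec.const 2)
      (Primrec.nat_add.comp (Primrec.nat_mul.comp (Primrec.nat_add.comp (Primrec.nat_mul.comp
        (Primrec.nat_add.comp (Primrec.const (t * k)) hi) (Primrec.const k)) hj)
        (Primrec.const L)) Primrec.snd)))
    (Primrec.nat_pow.comp (hb.comp hs) Primrec.snd))

theorem primrec_adjacency {Q : σ → List (List Bool)} (hQ : Primrec Q) :
    Primrec fun z : σ × ℕ × ℕ => ((Q z.1).getD z.2.1 []).getD z.2.2 false :=
  (Primrec.list_getD false).comp ((Primrec.list_getD []).comp (hQ.comp Primrec.fst)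
    (Primrec.fst.comp Primrec.snd)) (Primrec.snd.comp Primrec.snd)

end Primrec

theorem graphCode_getD {n : ℕ} (G : SimpleGraph (Fin n)) (i j : Fin n) :
    (((graphCode G).getD i []).getD j false) = true ↔ G.Adj i j := by
  simp [graphCode, List.getD_eq_getElem?_getD]

theorem length_graphCode {n : ℕ} (G : SimpleGraph (Fin n)) : (graphCode G).length = n := by
  simp [graphCode]

/-! ### The extraction algorithm -/

/-- The matrix `M̂` computed from the entries `E` of the sketch and the adjacency function `e` of the
query. -/
def natMhat (p k : ℕ) (e : ℕ → ℕ → Bool) (E : ℕ → ℕ → ℕ → ℕ) (u v : ℕ) : ℕ :=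
  if u < k then
    if v < k then natTutte p e (E 0) u v + E 1 u v else E 2 u (v - k)
  else if v < k then E 3 (u - k) v else 0

/-- The input of the extraction together with a prime. -/
abbrev ExtractInput := (List (List Bool) × List ℕ) × ℕ

namespace ExtractInput

variable (L k : ℕ) (s : ExtractInput)

/-- The matrix `M̂` of the input. -/
def mhat : ℕ → ℕ → ℕ :=
  natMhat s.2 k (fun i j => (s.1.1.getD i []).getD j false)
    (decodeWords (wordBase (s.1.2.getD 0 0)) L k s.1.2)

/-- The certificates for the rank of the matrix `M̂`. -/
def Cert (w : ℕ) : Prop := DiagCert s.2 (k + k) (fun _ => 1) (s.mhat L k) (codedEntry w)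

/-- The output that is computed with the help of a certificate. -/
def output (w : ℕ) : ℕ :=
  ((∑ u ∈ Finset.range (k + k), 1 * pivot (codedEntry w) u) + s.1.2.getD 1 0) / 2

theorem primrecMat_mhat : PrimrecMat fun s : ExtractInput => s.mhat L k := by
  have hu : Primrec fun z : ExtractInput × ℕ × ℕ => z.2.1 := Primrec.fst.comp Primrec.snd
  have hv : Primrec fun z : ExtractInput × ℕ × ℕ => z.2.2 := Primrec.snd.comp Primrec.snd
  have hs : Primrec fun z : ExtractInput × ℕ × ℕ => z.1 := Primrec.fst
  have hΓ : Primrec fun s : ExtractInput => s.1.2 := Primrec.snd.comp Primrec.fst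
  have hE : ∀ t, PrimrecMat fun s : ExtractInput =>
      decodeWords (wordBase (s.1.2.getD 0 0)) L k s.1.2 t := fun t =>
    primrecMat_decodeWords L k (primrec_wordBase.comp
      ((Primrec.list_getD 0).comp hΓ (Primrec.const 0))) hΓ t
  have huk := Primrec.nat_lt.comp hu (Primrec.const k)
  have hvk := Primrec.nat_lt.comp hv (Primrec.const k)
  have hT : PrimrecMat fun s : ExtractInput => natTutte s.2
      (fun i j => (s.1.1.getD i []).getD j false)
      (decodeWords (wordBase (s.1.2.getD 0 0)) L k s.1.2 0) :=
    PrimrecMat.natTutte (e := fun s i j => (s.1.1.getD i []).getD j false) Primrec.snd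
      (primrec_adjacency (Primrec.fst.comp Primrec.fst)) (hE 0)
  exact Primrec.ite huk
    (Primrec.ite hvk (Primrec.nat_add.comp hT (hE 1))
      ((hE 2).comp hs hu (Primrec.nat_sub.comp hv (Primrec.const k))))
    (Primrec.ite hvk ((hE 3).comp hs (Primrec.nat_sub.comp hu (Primrec.const k)) hv)
      (Primrec.const 0))

theorem primrecRel_cert : PrimrecRel fun (s : ExtractInput) w => s.Cert L k w :=
  primrecPred_diagCert (Primrec.snd.comp Primrec.fst) (Primrec.const _) (Primrec.const 1)
    ((primrecMat_mhat L k).comp (Primrec.fst.comp Primrec.fst) (Primrec.fst.comp Primrec.snd)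
      (Primrec.snd.comp Primrec.snd))
    fun t => primrecMat_codedEntry t Primrec.snd

theorem primrec_output : Primrec₂ fun (s : ExtractInput) w => s.output k w := by
  have h := primrec_pivot (σ := ExtractInput × ℕ) (g := fun s => codedEntry s.2)
    fun t => primrecMat_codedEntry t Primrec.snd
  exact Primrec.nat_div.comp (Primrec.nat_add.comp (Primrec.sum_range (Primrec.const _)
    (Primrec.nat_mul.comp (Primrec.const 1) h))
    ((Primrec.list_getD 0).comp (Primrec.snd.comp (Primrec.fst.comp Primrec.fst))
      (Primrec.const 1))) (Primrec.const 2)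

/-- This covers arbitrary lists, not only codes of queries and sketches, so the search of the
extraction is total. -/
theorem exists_cert [hp : Fact s.2.Prime] : ∃ w, s.Cert L k w := by
  obtain ⟨_, _, _, h⟩ := exists_codedEntry_castMat (p := s.2) (isIndexing_fin (k + k)) (s.mhat L k)
  obtain ⟨w, -, -, -, hw, -⟩ := h (fun _ _ _ => 0) (k + k + 9) (by omega) (by omega)
  exact ⟨w, hw⟩

end ExtractInput

theorem isIndexing_sum (k : ℕ) : IsIndexing (k + k) (fun _ => 1)
    (Sum.elim (fun i => (i : ℕ)) (fun i => k + i) : Fin k ⊕ Fin k → ℕ) where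
  injective := by
    rintro (i | i) (j | j) h <;> simp only [Sum.elim_inl, Sum.elim_inr] at h
    · rw [Fin.ext h]
    · omega
    · omega
    · rw [Fin.ext (by omega : (i : ℕ) = j)]
  lt := by rintro (i | i) <;> simp only [Sum.elim_inl, Sum.elim_inr] <;> omega
  eq_one _ := rfl
  exists_eq u hu _ := by
    by_cases h : u < k
    · exact ⟨.inl ⟨u, h⟩, rfl⟩
    · exact ⟨.inr ⟨u - k, by omega⟩, by simp only [Sum.elim_inr]; omega⟩

/-- The number of pivots in any certificate is the rank of `M̂`, so the output does not depend on
the certificate. -/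
theorem ExtractInput.output_eq {p k L n : ℕ} [Fact p.Prime] (hL : p ≤ wordBase n ^ L)
    (Q : SimpleGraph (Fin k)) (s : TutteSketch p k) {w : ℕ}
    (h : ExtractInput.Cert L k ((graphCode Q, encodeSketch L n s), p) w) :
    ExtractInput.output k ((graphCode Q, encodeSketch L n s), p) w = s.answer Q := by
  have hι := isIndexing_sum k
  rw [ExtractInput.Cert] at h
  have hdec : ∀ t < 4, ∀ i j : Fin k,
      (decodeWords (wordBase n) L k (encodeSketch L n s) t i j : ZMod p) = s.mat t i j := by
    intro t ht i j
    rw [decodeWords_encodeSketch hL s ht, ZMod.natCast_zmod_val]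
  have hM : castMat p (Sum.elim (fun i => (i : ℕ)) (fun i => k + i) : Fin k ⊕ Fin k → ℕ)
      (Sum.elim (fun i => (i : ℕ)) (fun i => k + i) : Fin k ⊕ Fin k → ℕ)
      (ExtractInput.mhat L k ((graphCode Q, encodeSketch L n s), p)) = s.Mhat Q := by
    have hn : (encodeSketch L n s).getD 0 0 = n := rfl
    have hT := castMat_natTutte Q (fun i j => ((graphCode Q).getD i []).getD j false)
      (decodeWords (wordBase n) L k (encodeSketch L n s) 0) s.Ahat (graphCode_getD Q)
      (hdec 0 (by omega))
    ext (i | i) (j | j)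
    · have := congrFun (congrFun hT i) j
      simp only [castMat, Matrix.of_apply] at this
      simp only [castMat, ExtractInput.mhat, natMhat, hn, TutteSketch.Mhat, Sum.elim_inl,
        Matrix.of_apply, i.2, j.2, if_true, Nat.cast_add, Matrix.fromBlocks_apply₁₁,
        Matrix.add_apply, this, hdec 1 (by omega), TutteSketch.mat]
    · simp only [castMat, ExtractInput.mhat, natMhat, hn, TutteSketch.Mhat, Sum.elim_inl,
        Sum.elim_inr, Matrix.of_apply, i.2, if_true, add_lt_iff_neg_left, Nat.not_lt_zero,
        if_false, add_tsub_cancel_left, Matrix.fromBlocks_apply₁₂, hdec 2 (by omega),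
        TutteSketch.mat]
    · simp only [castMat, ExtractInput.mhat, natMhat, hn, TutteSketch.Mhat, Sum.elim_inl,
        Sum.elim_inr, Matrix.of_apply, j.2, if_true, add_lt_iff_neg_left, Nat.not_lt_zero,
        if_false, add_tsub_cancel_left, Matrix.fromBlocks_apply₂₁, hdec 3 (by omega),
        TutteSketch.mat]
    · simp [castMat, ExtractInput.mhat, natMhat, TutteSketch.Mhat]
  have hr := h.rank_eq hι
  rw [hM] at hr
  rw [ExtractInput.output, ← hr]
  rfl

/-! ### The compression algorithm -/

/-- The input of the compression together with the numbers drawn and a prime. -/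
abbrev CompressInput := ((List (List Bool) × List ℕ) × List ℕ) × ℕ

namespace CompressInput

variable (L k : ℕ) (s : CompressInput)

/-- The number of vertices. -/
def order : ℕ := s.1.1.1.length

/-- The terminals. -/
def terminal (i : ℕ) : ℕ := s.1.1.2.getD i 0

/-- The evaluated Tutte matrix. -/
def tutte : ℕ → ℕ → ℕ :=
  natTutte s.2 (fun i j => (s.1.1.1.getD i []).getD j false)
    fun i j => s.1.2.getD (i * s.order + j) 0

/-- The numbers stored for the edges of a query. -/
def spare (i j : ℕ) : ℕ := s.1.2.getD (s.order * s.order + (i * k + j)) 0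

/-- The certificates for row and column operations and a choice of rows and columns. -/
def Cert (w : ℕ) : Prop := CompressCert s.2 s.order k s.tutte s.terminal (codedEntry w)

/-- The entries of the matrices of the sketch that a certificate describes. -/
def entry (w t i j : ℕ) : ℕ :=
  (if t = 0 then s.spare k i j
  else if t = 1 then eliminated s.2 s.order k s.tutte s.terminal (codedEntry w) i j
  else if t = 2 then pickedColumns s.order
    (terminalRows s.order k s.tutte s.terminal (codedEntry w)) (fun t => codedEntry w 5 t 0) i j
  else pickedColumns s.order
    (terminalCols s.order k s.tutte s.terminal (codedEntry w)) (fun t => codedEntry w 6 t 0) j i)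
  % s.2

/-- The output that is computed with the help of a certificate. -/
def output (w : ℕ) : List ℕ :=
  encodeWords s.order
    (∑ u ∈ Finset.range s.order, nonterminal k s.terminal u * pivot (codedEntry w) u)
    (wordBase s.order) L k (s.entry k w)

theorem primrec_order : Primrec order :=
  Primrec.list_length.comp (Primrec.fst.comp (Primrec.fst.comp Primrec.fst))

theorem primrec_terminal : Primrec₂ terminal :=
  (Primrec.list_getD 0).comp (Primrec.snd.comp (Primrec.fst.comp (Primrec.fst.comp Primrec.fst)))
    Primrec.snd

theorem primrec_nonterminal : Primrec₂ fun (s : CompressInput) u => nonterminal k s.terminal u :=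
  Primrec.ite (PrimrecPred.exists_lt_of (Primrec.const k) (Primrec.eq.comp
    (primrec_terminal.comp (Primrec.fst.comp Primrec.fst) Primrec.snd)
    (Primrec.snd.comp Primrec.fst))) (Primrec.const 0) (Primrec.const 1)

theorem primrecMat_tutte : PrimrecMat tutte := by
  refine PrimrecMat.natTutte Primrec.snd
    (primrec_adjacency (Primrec.fst.comp (Primrec.fst.comp Primrec.fst))) ?_
  exact (Primrec.list_getD 0).comp (Primrec.snd.comp (Primrec.fst.comp Primrec.fst))
    (Primrec.nat_add.comp (Primrec.nat_mul.comp (Primrec.fst.comp Primrec.snd)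
      (primrec_order.comp Primrec.fst)) (Primrec.snd.comp Primrec.snd))

theorem primrecMat_spare : PrimrecMat fun s : CompressInput => s.spare k := by
  have hn : Primrec fun z : CompressInput × ℕ × ℕ => z.1.order := primrec_order.comp Primrec.fst
  exact (Primrec.list_getD 0).comp (Primrec.snd.comp (Primrec.fst.comp Primrec.fst))
    (Primrec.nat_add.comp (Primrec.nat_mul.comp hn hn) (Primrec.nat_add.comp
      (Primrec.nat_mul.comp (Primrec.fst.comp Primrec.snd) (Primrec.const k))
      (Primrec.snd.comp Primrec.snd)))

section

variable {σ : Type*} [Primcodable σ] {s : σ → CompressInput} {w : σ → ℕ} (hs : Primrec s)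
  (hw : Primrec w)

include hs

theorem primrec_nonterminal_comp : Primrec₂ fun z u => nonterminal k (s z).terminal u :=
  (primrec_nonterminal k).comp (hs.comp Primrec.fst) Primrec.snd

include hw

theorem primrec_weight {f : ℕ → ℕ} (hf : Primrec f) :
    Primrec₂ fun z u => nonterminal k (s z).terminal u * f (pivot (codedEntry (w z)) u) :=
  Primrec.nat_mul.comp (primrec_nonterminal_comp k hs)
    (hf.comp (primrec_pivot fun t => primrecMat_codedEntry t hw))

theorem primrecMat_terminalRows : PrimrecMat fun z =>
    terminalRows (s z).order k (s z).tutte (s z).terminal (codedEntry (w z)) := by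
  refine PrimrecMat.natMul (primrec_order.comp hs) (primrec_nonterminal_comp k hs) ?_
    (primrecMat_codedEntry 2 hw)
  have hs' : Primrec fun z : σ × ℕ × ℕ => s z.1 := hs.comp Primrec.fst
  exact primrecMat_tutte.comp hs' (primrec_terminal.comp hs' (Primrec.fst.comp Primrec.snd))
    (Primrec.snd.comp Primrec.snd)

theorem primrecMat_terminalCols : PrimrecMat fun z =>
    terminalCols (s z).order k (s z).tutte (s z).terminal (codedEntry (w z)) := by
  have h : PrimrecMat fun z => natMul (s z).order (nonterminal k (s z).terminal)
      (codedEntry (w z) 0) fun u j => (s z).tutte u ((s z).terminal j) := by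
    refine PrimrecMat.natMul (primrec_order.comp hs) (primrec_nonterminal_comp k hs)
      (primrecMat_codedEntry 0 hw) ?_
    have hs' : Primrec fun z : σ × ℕ × ℕ => s z.1 := hs.comp Primrec.fst
    exact primrecMat_tutte.comp hs' (Primrec.fst.comp Primrec.snd)
      (primrec_terminal.comp hs' (Primrec.snd.comp Primrec.snd))
  exact h.comp Primrec.fst (Primrec.snd.comp Primrec.snd) (Primrec.fst.comp Primrec.snd)

theorem primrecMat_eliminated : PrimrecMat fun z =>
    eliminated (s z).2 (s z).order k (s z).tutte (s z).terminal (codedEntry (w z)) := by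
  have hs' : Primrec fun z : σ × ℕ × ℕ => s z.1 := hs.comp Primrec.fst
  have hcols : PrimrecMat fun z u j =>
      terminalCols (s z).order k (s z).tutte (s z).terminal (codedEntry (w z)) j u :=
    (primrecMat_terminalCols k hs hw).comp Primrec.fst (Primrec.snd.comp Primrec.snd)
      (Primrec.fst.comp Primrec.snd)
  exact Primrec.nat_add.comp
    (primrecMat_tutte.comp hs' (primrec_terminal.comp hs' (Primrec.fst.comp Primrec.snd))
      (primrec_terminal.comp hs' (Primrec.snd.comp Primrec.snd)))
    (Primrec.nat_mul.comp (Primrec.nat_sub.comp (Primrec.snd.comp hs') (Primrec.const 1))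
      (PrimrecMat.natMul (primrec_order.comp hs) (primrec_weight k hs hw (f := id) Primrec.id)
        (primrecMat_terminalRows k hs hw) hcols))

end

theorem primrecRel_cert : PrimrecRel fun (s : CompressInput) w => s.Cert k w := by
  have hs : Primrec fun z : CompressInput × ℕ => z.1 := Primrec.fst
  have hw : Primrec fun z : CompressInput × ℕ => z.2 := Primrec.snd
  have hg := fun t => primrecMat_codedEntry t hw
  have hp : Primrec fun z : CompressInput × ℕ => z.1.2 := Primrec.snd.comp hs
  have hn := primrec_order.comp hs
  have hμ := primrec_weight k hs hw (f := fun x => 1 - x)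
    (Primrec.nat_sub.comp (Primrec.const 1) Primrec.id)
  have hc : ∀ t, Primrec₂ fun (z : CompressInput × ℕ) i => codedEntry z.2 t i 0 := fun t =>
    (hg t).comp Primrec.fst Primrec.snd (Primrec.const 0)
  have hM : PrimrecMat fun z : CompressInput × ℕ => z.1.tutte :=
    primrecMat_tutte.comp (hs.comp Primrec.fst) (Primrec.fst.comp Primrec.snd)
      (Primrec.snd.comp Primrec.snd)
  exact (primrecPred_diagCert hp hn (primrec_nonterminal_comp k hs) hM hg).and
    ((primrecPred_pickCert k hp hn hμ (primrecMat_terminalRows k hs hw) (hc 5) (hg 7)).and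
      (primrecPred_pickCert k hp hn hμ (primrecMat_terminalCols k hs hw) (hc 6) (hg 8)))

theorem primrec_output : Primrec₂ fun (s : CompressInput) w => s.output L k w := by
  have hs : Primrec fun z : CompressInput × ℕ => z.1 := Primrec.fst
  have hw : Primrec fun z : CompressInput × ℕ => z.2 := Primrec.snd
  have hn := primrec_order.comp hs
  refine primrec_encodeWords L k hn (Primrec.sum_range hn
    (primrec_weight k hs hw (f := id) Primrec.id)) (primrec_wordBase.comp hn) ?_
  have hc : ∀ t, Primrec₂ fun (z : CompressInput × ℕ) i => codedEntry z.2 t i 0 := fun t =>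
    (primrecMat_codedEntry t hw).comp Primrec.fst Primrec.snd (Primrec.const 0)
  have hz : Primrec fun z : (CompressInput × ℕ) × ℕ × ℕ × ℕ => z.1 := Primrec.fst
  have ht : Primrec fun z : (CompressInput × ℕ) × ℕ × ℕ × ℕ => z.2.1 :=
    Primrec.fst.comp Primrec.snd
  have hi : Primrec fun z : (CompressInput × ℕ) × ℕ × ℕ × ℕ => z.2.2.1 :=
    Primrec.fst.comp (Primrec.snd.comp Primrec.snd)
  have hj : Primrec fun z : (CompressInput × ℕ) × ℕ × ℕ × ℕ => z.2.2.2 :=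
    Primrec.snd.comp (Primrec.snd.comp Primrec.snd)
  refine Primrec.nat_mod.comp (Primrec.ite (Primrec.eq.comp ht (Primrec.const 0)) ?_
    (Primrec.ite (Primrec.eq.comp ht (Primrec.const 1)) ?_
      (Primrec.ite (Primrec.eq.comp ht (Primrec.const 2)) ?_ ?_)))
    (Primrec.snd.comp (Primrec.fst.comp hz))
  · exact (primrecMat_spare k).comp (Primrec.fst.comp hz) hi hj
  · exact (primrecMat_eliminated k hs hw).comp hz hi hj
  · exact (primrecMat_pickedColumns hn (primrecMat_terminalRows k hs hw) (hc 5)).comp hz hi hj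
  · exact (primrecMat_pickedColumns hn (primrecMat_terminalCols k hs hw) (hc 6)).comp hz hj hi

theorem exists_cert [hp : Fact s.2.Prime] : ∃ w, s.Cert k w :=
  exists_compressCert s.order k s.tutte s.terminal

/-- The entries are reduced modulo `p` and hence are the canonical representatives that
`encodeSketch` stores. -/
theorem output_eq {p : ℕ} [Fact p.Prime] (a : List (List Bool) × List ℕ) (ω : List ℕ) (w : ℕ) :
    output L k ((a, ω), p) w = encodeSketch L a.1.length (certSketch p a.1.length k
      (tutte ((a, ω), p)) (terminal ((a, ω), p)) (spare k ((a, ω), p)) (codedEntry w)) := by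
  refine encodeWords_congr fun t ht i hi j hj => ?_
  rw [TutteSketch.entry, dif_pos ⟨hi, hj⟩]
  have : t = 0 ∨ t = 1 ∨ t = 2 ∨ t = 3 := by omega
  rcases this with rfl | rfl | rfl | rfl
  all_goals
    simp [entry, TutteSketch.mat, certSketch, castMat, ZMod.val_natCast]
    try rfl

end CompressInput

/-! ### The prime, the random draws and the assembled scheme. -/

/-- Bertrand's postulate guarantees that the search ends, and trial division decides primality. The
summand 1 keeps the interval nonempty for `n = 0`. -/
theorem exists_computable_prime (N : ℕ) : ∃ p : ℕ → ℕ, Computable p ∧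
    ∀ n, (p n).Prime ∧ n * N + 1 < p n ∧ p n ≤ 2 * (n * N + 1) := by
  have hprime : PrimrecPred Nat.Prime := by
    have hdvd : PrimrecRel fun q m : ℕ => q % m = 0 → m = 1 :=
      (Primrec.eq.comp (Primrec.nat_mod.comp Primrec.fst Primrec.snd) (Primrec.const 0)).imp
        (Primrec.eq.comp Primrec.snd (Primrec.const 1))
    refine (PrimrecPred.and (Primrec.nat_le.comp (Primrec.const 2) Primrec.id)
      (.forall_lt_of Primrec.id hdvd)).of_eq fun q => ?_
    simp [Nat.prime_def_lt, Nat.dvd_iff_mod_eq_zero]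
  have hm : Primrec fun z : ℕ × ℕ => z.1 * N + 1 :=
    Primrec.succ.comp (Primrec.nat_mul.comp Primrec.fst (Primrec.const N))
  have hP : PrimrecRel fun n q : ℕ => q.Prime ∧ n * N + 1 < q ∧ q ≤ 2 * (n * N + 1) :=
    (hprime.comp Primrec.snd).and ((Primrec.nat_lt.comp hm Primrec.snd).and
      (Primrec.nat_le.comp Primrec.snd (Primrec.nat_mul.comp (Primrec.const 2) hm)))
  exact exists_computable_search hP Computable.id fun n =>
    Nat.exists_prime_lt_and_le_two_mul (n * N + 1) (Nat.succ_ne_zero _)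

theorem RandomizedAlgorithm.dist_eq_map {α β : Type} [Primcodable α] [Primcodable β]
    (A : RandomizedAlgorithm α β) (a : α) {Ω : Type*} [Fintype Ω] [Nonempty Ω] {d m : ℕ}
    (hd : A.draws a = d) (hm : A.bound a + 1 = m) (e : (Fin d → Fin m) ≃ Ω) (F : Ω → β)
    (h : ∀ ω, A.run a (List.ofFn fun i => ((e.symm ω i : Fin m) : ℕ)) = F ω) :
    A.dist a = (PMF.uniformOfFintype Ω).map F := by
  classical
  subst hd hm
  have hunif : PMF.uniformOfFintype Ω =
      (PMF.uniformOfFintype (Fin (A.draws a) → Fin (A.bound a + 1))).map e := by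
    ext b
    rw [PMF.map_uniformOfFintype_apply, PMF.uniformOfFintype_apply, Fintype.card_congr e]
    have : (Finset.univ.filter fun ω => e ω = b) = {e.symm b} := by
      ext ω
      simp [Equiv.eq_symm_apply]
    rw [this]
    simp
  rw [hunif, PMF.map_comp, RandomizedAlgorithm.dist]
  congr 1
  funext ω
  rw [Function.comp_apply, ← h, Equiv.symm_apply_apply]

/-- The residue classes of `0, …, p - 1`. -/
def finEquivZMod (p : ℕ) [NeZero p] : Fin p ≃ ZMod p where
  toFun i := (i : ℕ)
  invFun z := ⟨z.val, ZMod.val_lt z⟩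
  left_inv i := Fin.ext (ZMod.val_cast_of_lt i.2)
  right_inv z := ZMod.natCast_zmod_val z

/-- The positions of the entries of two square matrices in a list, row by row. -/
def drawIndex (n k : ℕ) : (Fin n × Fin n) ⊕ (Fin k × Fin k) ≃ Fin (n * n + k * k) :=
  (finProdFinEquiv.sumCongr finProdFinEquiv).trans finSumFinEquiv

/-- Lists of numbers below `p` as pairs of matrices over `ℤ/p`. -/
def drawEquiv (n k p : ℕ) [NeZero p] : (Fin (n * n + k * k) → Fin p) ≃
    (Fin n → Fin n → ZMod p) × (Fin k → Fin k → ZMod p) :=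
  (((drawIndex n k).symm.arrowCongr (finEquivZMod p)).trans
    (Equiv.sumArrowEquivProdArrow _ _ _)).trans
      ((Equiv.curry _ _ _).prodCongr (Equiv.curry _ _ _))

theorem drawEquiv_fst {n k p : ℕ} [NeZero p] (ω : Fin (n * n + k * k) → Fin p) (i j : Fin n) :
    (((List.ofFn fun t => (ω t : ℕ)).getD (i * n + j) 0 : ℕ) : ZMod p) =
      (drawEquiv n k p ω).1 i j := by
  have h : ((drawIndex n k (.inl (i, j)) : Fin _) : ℕ) = i * n + j := by
    simp [drawIndex, mul_comm, add_comm]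
  rw [← h]
  simp [List.getD_eq_getElem?_getD, drawEquiv, finEquivZMod]

theorem drawEquiv_snd {n k p : ℕ} [NeZero p] (ω : Fin (n * n + k * k) → Fin p) (i j : Fin k) :
    (((List.ofFn fun t => (ω t : ℕ)).getD (n * n + (i * k + j)) 0 : ℕ) : ZMod p) =
      (drawEquiv n k p ω).2 i j := by
  have h : ((drawIndex n k (.inr (i, j)) : Fin _) : ℕ) = n * n + (i * k + j) := by
    simp [drawIndex, mul_comm, add_comm]
  rw [← h]
  simp [List.getD_eq_getElem?_getD, drawEquiv, finEquivZMod]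

/-- The extraction does not see `G`; it learns `n` from the first word of the sketch and from it the
prime and the base. It draws no random numbers. -/
theorem exists_sketchingScheme {p : ℕ → ℕ} (hp : Computable p) [hprime : ∀ n, Fact (p n).Prime]
    {L k : ℕ} (hL : ∀ n, p n ≤ wordBase n ^ L) (hk : 1 ≤ k) :
    ∃ S : SketchingScheme, S.StoresTutteSketch k p ∧ S.HasSize k ((4 * k * k * L + 2 : ℕ) : ℝ) := by
  have hlen : Computable fun a : List (List Bool) × List ℕ => a.1.length :=
    (Primrec.list_length.comp Primrec.fst).to_comp
  obtain ⟨fc, hfc, hcert⟩ := exists_computable_search (CompressInput.primrecRel_cert k)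
    (g := fun a : (List (List Bool) × List ℕ) × List ℕ => (a, p a.1.1.length))
    (Computable.pair Computable.id (hp.comp (hlen.comp Computable.fst)))
    fun a => CompressInput.exists_cert k _ (hp := hprime _)
  obtain ⟨fe, hfe, hcert'⟩ := exists_computable_search (ExtractInput.primrecRel_cert L k)
    (g := fun a : List (List Bool) × List ℕ => (a, p (a.2.getD 0 0)))
    (Computable.pair Computable.id (hp.comp
      ((Primrec.list_getD 0).comp Primrec.snd (Primrec.const 0)).to_comp))
    fun a => ExtractInput.exists_cert L k _ (hp := hprime _)
  let S : SketchingScheme :=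
    { compress :=
        { draws := fun a => a.1.length * a.1.length + k * k
          -- Draws range over `{0, …, bound}`, here a full system of residues.
          bound := fun a => p a.1.length - 1
          run := fun a ω => CompressInput.output L k ((a, ω), p a.1.length) (fc (a, ω))
          computable_draws := (Primrec.nat_add.comp (Primrec.nat_mul.comp
            (Primrec.list_length.comp Primrec.fst) (Primrec.list_length.comp Primrec.fst))
            (Primrec.const (k * k))).to_comp
          computable_bound := Primrec.pred.to_comp.comp (hp.comp hlen)
          computable_run := (CompressInput.primrec_output L k).to_comp.comp
            (Computable.pair Computable.id (hp.comp (hlen.comp Computable.fst))) hfc }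
      extract :=
        { draws := fun _ => 0
          bound := fun _ => 0
          run := fun a _ => ExtractInput.output k (a, p (a.2.getD 0 0)) (fe a)
          computable_draws := Computable.const 0
          computable_bound := Computable.const 0
          computable_run := ((ExtractInput.primrec_output k).to_comp.comp
            (Computable.pair Computable.id (hp.comp
              ((Primrec.list_getD 0).comp Primrec.snd (Primrec.const 0)).to_comp)) hfe).comp
                Computable.fst } }
  have hcomp : ∀ (n : ℕ) (G : SimpleGraph (Fin n)) (q : Fin k ↪ Fin n),
      ∃ sketch : (Fin n → Fin n → ZMod (p n)) → (Fin k → Fin k → ZMod (p n)) →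
          TutteSketch (p n) k,
        (∀ x a, IsTutteSketch G q x a (sketch x a)) ∧
        S.sketchDist G q = (PMF.uniformOfFintype
            ((Fin n → Fin n → ZMod (p n)) × (Fin k → Fin k → ZMod (p n)))).map
              fun ω => encodeSketch L n (sketch ω.1 ω.2) := by
    intro n G q
    let code (ω : (Fin n → Fin n → ZMod (p n)) × (Fin k → Fin k → ZMod (p n))) : List ℕ :=
      List.ofFn fun i => (((drawEquiv n k (p n)).symm ω i : Fin (p n)) : ℕ)
    have hn : (inputCode G q).1.length = n := length_graphCode G
    let s (ω : (Fin n → Fin n → ZMod (p n)) × (Fin k → Fin k → ZMod (p n))) : CompressInput :=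
      ((inputCode G q, code ω), p n)
    let w (ω : (Fin n → Fin n → ZMod (p n)) × (Fin k → Fin k → ZMod (p n))) : ℕ :=
      fc (inputCode G q, code ω)
    refine ⟨fun x a => certSketch (p n) n k (s (x, a)).tutte (s (x, a)).terminal
      ((s (x, a)).spare k) (codedEntry (w (x, a))), fun x a => ?_, ?_⟩
    · have hc : CompressCert (p n) n k (s (x, a)).tutte (s (x, a)).terminal
          (codedEntry (w (x, a))) := by
        have := hcert (inputCode G q, code (x, a))
        simp only [hn] at this
        have h2 : CompressCert (p n) (inputCode G q).1.length k (s (x, a)).tutte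
          (s (x, a)).terminal (codedEntry (w (x, a))) := this
        rwa [hn] at h2
      have hdraw := (drawEquiv n k (p n)).apply_symm_apply (x, a)
      have horder : (s (x, a)).order = n := hn
      refine hc.isTutteSketch (fun i => ?_) ?_ fun i j => ?_
      · simp [s, CompressInput.terminal, inputCode, List.getD_eq_getElem?_getD]
      · refine castMat_natTutte G _ _ x (graphCode_getD G) fun i j => ?_
        rw [horder]
        exact (drawEquiv_fst _ i j).trans (by rw [hdraw])
      · rw [CompressInput.spare, horder]
        exact (drawEquiv_snd _ i j).trans (by rw [hdraw])
    · refine RandomizedAlgorithm.dist_eq_map S.compress (inputCode G q) (d := n * n + k * k)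
        (m := p n) ?_ ?_ (drawEquiv n k (p n)) _ fun ω => ?_
      · change (inputCode G q).1.length * (inputCode G q).1.length + k * k = _
        rw [hn]
      · change p (inputCode G q).1.length - 1 + 1 = _
        rw [hn]
        exact Nat.succ_pred_prime (hprime n).out
      · change CompressInput.output L k ((inputCode G q, code ω), p (inputCode G q).1.length) (w ω)
          = _
        rw [hn, CompressInput.output_eq, hn]
  refine ⟨S, ⟨fun n => encodeSketch L n, fun n => (encodeSketch_injective (hL n)).injOn, hcomp,
    fun n s Q hkn hr => ?_⟩, fun n G q Γ hΓ => ?_⟩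
  · have hc := hcert' (graphCode Q, encodeSketch L n s)
    change ExtractInput.Cert L k ((graphCode Q, encodeSketch L n s), p n) _ at hc
    rw [RandomizedAlgorithm.dist, ← ExtractInput.output_eq (hL n) Q s hc]
    exact PMF.map_const _ _
  · obtain ⟨sketch, hsk, hdist⟩ := hcomp n G q
    rw [hdist, PMF.support_map] at hΓ
    obtain ⟨ω, -, rfl⟩ := hΓ
    have hkn : k ≤ n := by simpa using Fintype.card_le_of_embedding q
    -- Since `n ≥ k ≥ 1`, the base is `n + 1`. All words, including `n` and `r`, are then at most
    -- `n` and fit into `Nat.size n` bits.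
    have hbase : wordBase n = n + 1 := max_eq_right (by omega)
    constructor
    · intro u hu
      have := mem_encodeWords_lt (by omega) ((hsk ω.1 ω.2).r_le.trans_lt (by omega)) hu
      exact this.trans_le (hbase ▸ Nat.lt_size_self n)
    · exact_mod_cast (length_encodeWords _ _ _ _ _ _).le

/-! ### The size bound and the constants. -/

theorem SketchingScheme.HasSize.mono {S : SketchingScheme} {k : ℕ} {s t : ℝ} (h : S.HasSize k s)
    (hst : s ≤ t) : S.HasSize k t := fun n G q Γ hΓ =>
  ⟨(h n G q Γ hΓ).1, (h n G q Γ hΓ).2.trans hst⟩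

/-- Taking logarithms in `2 ^ (size - 1) ≤ m ≤ 4 / δ` gives `(size - 3) * log 2 ≤ log (1 / δ)`, and
`log 2 > 1/2`. -/
theorem Nat.size_le_of_le_div {m : ℕ} {δ : ℝ} (hδ : 0 < δ) (hδ1 : δ ≤ 1) (hm : m ≠ 0)
    (h : (m : ℝ) ≤ 4 / δ) :
    (m.size : ℝ) ≤ 3 + 2 * Real.log (1 / δ) := by
  have h1 : 2 ^ (m.size - 1) ≤ m := by
    have := Nat.size_pos.2 (Nat.pos_of_ne_zero hm)
    exact Nat.lt_size.1 (by omega)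
  have h2 : (2 : ℝ) ^ (m.size - 1) ≤ 4 / δ := le_trans (by exact_mod_cast h1) h
  have h3 := Real.log_le_log (by positivity) h2
  have hs : ((m.size - 1 : ℕ) : ℝ) = m.size - 1 := by
    rw [Nat.cast_sub (Nat.size_pos.2 (Nat.pos_of_ne_zero hm))]
    simp
  have h4 : Real.log 4 = 2 * Real.log 2 := by
    rw [show (4 : ℝ) = 2 ^ 2 by norm_num, Real.log_pow]
    norm_num
  rw [Real.log_pow, hs, div_eq_mul_one_div, Real.log_mul (by norm_num) (by positivity), h4] at h3
  have hlog2 := Real.log_two_gt_d9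
  by_contra! hlt
  have h5 : (m.size - 3 : ℝ) * Real.log 2 ≤ Real.log (1 / δ) := by linarith
  rcases le_or_gt 3 (m.size : ℝ) with h6 | h6
  · nlinarith
  · have := Real.log_nonneg ((one_le_div hδ).2 hδ1)
    linarith

theorem theorem1 :
    ∃ C : ℝ, ∀ δ : ℝ, 0 < δ → δ < 1 → ∀ k : ℕ, 1 ≤ k →
      ∃ S : SketchingScheme,
        S.HasSize k (C * (k : ℝ) ^ 2 * max 1 (Real.log (1 / δ))) ∧
        S.Answers k matchingNumber δ ∧
        ∃ (p : ℕ → ℕ) (_ : ∀ n, Fact (p n).Prime),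
          (∀ n : ℕ, 1 ≤ n → (n : ℝ) / δ ≤ p n ∧ (p n : ℝ) ≤ C * (n / δ)) ∧
          S.StoresTutteSketch k p := by
  -- With `L ≤ 6 * max 1 (log (1/δ))`, the length `4 * k² * L + 2` costs `24 + 2`. The bound on the
  -- prime would need only 6.
  refine ⟨26, fun δ hδ hδ1 k hk => ?_⟩
  -- Only this integer enters the algorithms, so `δ` may be any real number, computable or not.
  let N := ⌈1 / δ⌉₊
  have hinv : 1 < 1 / δ := by rwa [lt_div_iff₀ hδ, one_mul]
  have hN : 1 / δ ≤ N := Nat.le_ceil _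
  have hN2 : (N : ℝ) ≤ 2 / δ := by
    have := Nat.ceil_lt_add_one (zero_le_one.trans hinv.le)
    have h2 : 2 / δ = 1 / δ + 1 / δ := by ring
    linarith
  have hN1 : 1 ≤ N := Nat.one_le_iff_ne_zero.2 (Nat.ceil_pos.2 (by linarith)).ne'
  obtain ⟨p, hp, hspec⟩ := exists_computable_prime N
  have hprime : ∀ n, Fact (p n).Prime := fun n => ⟨(hspec n).1⟩
  have hlow : ∀ n : ℕ, (n : ℝ) / δ ≤ p n := by
    intro n
    calc (n : ℝ) / δ = n * (1 / δ) := by ring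
      _ ≤ n * N := by gcongr
      _ ≤ p n := by exact_mod_cast ((Nat.lt_succ_self _).trans (hspec n).2.1).le
  -- The prime is at most `2 * N * (n + 1)`. One digit in the base covers `n + 1`; `(2 * N).size`
  -- digits, each worth a factor of at least 2, cover `2 * N`. Hence `L` does not depend on `n`.
  let L := (2 * N).size + 1
  have hL : ∀ n, p n ≤ wordBase n ^ L := by
    intro n
    have h1 : n + 1 ≤ wordBase n := le_max_right _ _
    -- The maximum with 2 in the base serves the case `n = 0`.
    have h2 : 2 ≤ wordBase n := le_max_left _ _
    calc p n ≤ 2 * (n * N + 1) := (hspec n).2.2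
      _ ≤ 2 * N * (n + 1) := by nlinarith
      _ ≤ 2 ^ (2 * N).size * (n + 1) := by gcongr; exact (Nat.lt_size_self _).le
      _ ≤ wordBase n ^ (2 * N).size * wordBase n := by gcongr
      _ = wordBase n ^ L := (pow_succ _ _).symm
  obtain ⟨S, hS, hsize⟩ := exists_sketchingScheme hp hL hk
  refine ⟨S, hsize.mono ?_, hS.answers hδ hlow, p, hprime, fun n hn => ⟨hlow n, ?_⟩, hS⟩
  · have h1 := Nat.size_le_of_le_div (m := 2 * N) hδ hδ1.le (by omega) (by
      push_cast
      calc (2 : ℝ) * N ≤ 2 * (2 / δ) := by gcongr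
        _ = 4 / δ := by ring)
    have h2 : (L : ℝ) ≤ 6 * max 1 (Real.log (1 / δ)) := by
      have := le_max_left 1 (Real.log (1 / δ))
      have := le_max_right 1 (Real.log (1 / δ))
      have h3 : (L : ℝ) = (2 * N).size + 1 := by simp [L]
      rw [h3]
      linarith
    have hk1 : (1 : ℝ) ≤ k := by exact_mod_cast hk
    have h3 : (1 : ℝ) ≤ (k : ℝ) ^ 2 * max 1 (Real.log (1 / δ)) :=
      one_le_mul_of_one_le_of_one_le (one_le_pow₀ hk1) (le_max_left _ _)
    calc (((4 * k * k * L + 2 : ℕ) : ℕ) : ℝ) = 4 * (k : ℝ) ^ 2 * L + 2 := by push_cast; ring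
      _ ≤ 4 * (k : ℝ) ^ 2 * (6 * max 1 (Real.log (1 / δ))) +
          2 * ((k : ℝ) ^ 2 * max 1 (Real.log (1 / δ))) := by gcongr; linarith
      _ = 26 * (k : ℝ) ^ 2 * max 1 (Real.log (1 / δ)) := by ring
  · have hn1 : (1 : ℝ) ≤ n := by exact_mod_cast hn
    have h1 : (p n : ℝ) ≤ 2 * (n * N + 1) := by exact_mod_cast (hspec n).2.2
    have h2 : (n : ℝ) * N ≤ n * (2 / δ) := by gcongr
    have h3 : (1 : ℝ) ≤ n / δ := by
      rw [le_div_iff₀ hδ]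
      linarith
    have h4 : (n : ℝ) * (2 / δ) = 2 * (n / δ) := by ring
    linarith
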